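/- Let $n\ge 2$, let $S_n(1)=\{x\in\mathbb R^n: x\ge 0,\ \sum_i x_i=1\}$, and let $U$ and $\overline U$ be the open and closed Euclidean $\mu_0$-neighbourhoods of $S_n(1)$. Let $\eta$ be a random element and let $f(x;\eta)$, $x\in\overline U$, be integrable for every $x$. Put $f(x)=E_\eta[f(x;\eta)]$ and $f_*=\min_{x\in S_n(1)}f(x)$. Suppose that: 1. for almost every $\eta$ the function $x\mapsto f(x;\eta)$ is convex on $\overline U$ and differentiable on $U$; 2. $E_\eta[\nabla_x f(x;\eta)]=\nabla f(x)$ for all $x\in U$; 3. for almost every $\eta$, $|f(x;\eta)-f(y;\eta)|\le M_2(\eta)\|x-y\|_2$ for all $x,y\in\overline U$, where $0<M_2:=\sqrt{E[M_2(\eta)^2]}<\infty$; 4. for almost every $\eta$, $\|\nabla_x f(x;\eta)-\nabla_x f(y;\eta)\|_2\le L_2(\eta)\|x-y\|_2$ for all $x,y\in U$, where $0<L_2:=\sqrt{E[L_2(\eta)^2]}<\infty$. Let $\varepsilon>0$ and $$\mu=\min\left\{\max\left\{\frac{\varepsilon}{2M_2},\sqrt{\frac{\varepsilon}{L_2}}\right\},\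 \frac{M_2}{L_2}\sqrt{\frac1{6n}}\right\},\qquad \mu\le\mu_0,\qquad \delta\le\frac{M_2\,\mu}{\sqrt{96\,n}} .$$ At step $k=1,2,\dots$ a direction $e^k$, uniformly distributed on the Euclidean unit sphere of $\mathbb R^n$, and a realization $\eta^k$, distributed as $\eta$, are drawn, and a noisy oracle is queried at two points with the same realization; it returns $f(x^k+\mu e^k;\eta^k)+\xi^k$ and $f(x^k;\eta^k)+\xi_0^k$. Call the collection of all $(e^j,\eta^j,\xi^j,\xi_0^j)$ with $j<k$ the past of step $k$. The realization $\eta^k$ is independent of the past, the direction $e^k$ is independent of the pair (past, $\eta^k$), and the noises satisfy $|\xi^k|\le\delta$, $|\xi_0^k|\le\delta$ almost surely and do not depend on the direction, in the sense that $e^k$ is independent of (past, $\xi^k$) and of (past, $\xi_0^k$); the noises may depend on $\eta^k$. Put $$g^k=\frac n\mu\Big(f(x^k+\mu e^k;\eta^k)+\xi^k-\big(f(x^k;\eta^k)+\xi_0^k\big)\Big)e^k ,$$ and let the iterates be $x^1_i=1/n$ and, for $t\ge1$, $$x_i^{t+1}=\frac{\exp\left(-\frac1{\beta_{t+1}}\sum_{k=1}^t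 g^k_i\right)}{\sum_{l=1}^n\exp\left(-\frac1{\beta_{t+1}}\sum_{k=1}^t g^k_l\right)},\quad i=1,\dots,n,\qquad \beta_t=M_2\sqrt{5t}.$$ Then for $N=\left\lceil 80\,M_2^2\ln^2 n/\varepsilon^2\right\rceil$ the minimum $f_*$ is attained, the random variable $f\big(\frac1N\sum_{k=1}^N x^k\big)$ is integrable, and $$E\left[f\Big(\frac1N\sum_{k=1}^N x^k\Big)\right]-f_*\le\varepsilon .$$ -/

import Mathlib

open MeasureTheory ProbabilityTheory

noncomputable section

namespace GradientFree

/-- `ℝⁿ` with the Euclidean norm. -/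
abbrev Vec (n : ℕ) : Type := EuclideanSpace ℝ (Fin n)

/-- The unit simplex `S_n(1) = {x ≥ 0 : ∑ xᵢ = 1}`. -/
def simplex (n : ℕ) : Set (Vec n) := {x | (∀ i, 0 ≤ x i) ∧ ∑ i, x i = 1}

/-- The closed `μ₀`-neighbourhood of the simplex; the functions are given there. -/
def closedNhd (n : ℕ) (μ₀ : ℝ) : Set (Vec n) := Metric.cthickening μ₀ (simplex n)

/-- The open `μ₀`-neighbourhood of the simplex; gradients are considered there. -/
def openNhd (n : ℕ) (μ₀ : ℝ) : Set (Vec n) := Metric.thickening μ₀ (simplex n)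

/-- The uniform distribution on the Euclidean unit sphere, as a measure on `ℝⁿ`: the normalised
surface measure. -/
def uniformSphere (n : ℕ) : Measure (Vec n) :=
  (((volume : Measure (Vec n)).toSphere Set.univ)⁻¹ •
    (volume : Measure (Vec n)).toSphere).map Subtype.val

/-- The root mean square `√(E[K(η)²])`. -/
def rms {H : Type*} [MeasurableSpace H] (ν : Measure H) (K : H → ℝ) : ℝ :=
  Real.sqrt (∫ h, K h ^ 2 ∂ν)

/-- The objective `f(x) = E_η[f(x; η)]`, where `ν` is the law of `η`. -/
def objective {n : ℕ} {H : Type*} [MeasurableSpace H] (ν : Measure H)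
    (f : Vec n → H → ℝ) (x : Vec n) : ℝ :=
  ∫ h, f x h ∂ν

/-- The smooth stochastic convex setting on the `μ₀`-neighbourhood of the simplex.  `K` and `L` are
the random Lipschitz constants `M₂(η)` of `f(·; η)` and `L₂(η)` of its gradient, in the Euclidean
norm. -/
structure SmoothSetting {n : ℕ} {H : Type*} [MeasurableSpace H] (ν : Measure H) (μ₀ : ℝ)
    (f : Vec n → H → ℝ) (K L : H → ℝ) : Prop where
  /-- The expectation `E_η[f(x; η)]` exists. -/
  integrable : ∀ x ∈ closedNhd n μ₀, Integrable (f x) ν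
  /-- `f(·; η)` is convex. -/
  convex : ∀ᵐ h ∂ν, ConvexOn ℝ (closedNhd n μ₀) (fun x => f x h)
  /-- `E_η[∇ₓ f(x; η)] = ∇ₓ E_η[f(x; η)]`. -/
  gradient_expectation : ∀ x ∈ openNhd n μ₀,
    Integrable (fun h => gradient (fun y => f y h) x) ν ∧
      HasGradientAt (objective ν f) (∫ h, gradient (fun y => f y h) x ∂ν) x
  /-- `|f(x; η) - f(y; η)| ≤ M₂(η) ‖x - y‖₂`. -/
  lipschitz : ∀ᵐ h ∂ν, ∀ x ∈ closedNhd n μ₀, ∀ y ∈ closedNhd n μ₀,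
    |f x h - f y h| ≤ K h * ‖x - y‖
  /-- `E[M₂(η)²] < ∞`. -/
  lipschitz_memLp : MemLp K 2 ν
  /-- `f(·; η)` is differentiable. -/
  differentiable : ∀ᵐ h ∂ν, ∀ x ∈ openNhd n μ₀, DifferentiableAt ℝ (fun y => f y h) x
  /-- `‖∇ₓ f(x; η) - ∇ₓ f(y; η)‖₂ ≤ L₂(η) ‖x - y‖₂`. -/
  gradient_lipschitz : ∀ᵐ h ∂ν, ∀ x ∈ openNhd n μ₀, ∀ y ∈ openNhd n μ₀,
    ‖gradient (fun z => f z h) x - gradient (fun z => f z h) y‖ ≤ L h * ‖x - y‖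
  /-- `E[L₂(η)²] < ∞`. -/
  gradient_lipschitz_memLp : MemLp L 2 ν

/-- Everything drawn before step `k`: directions, realisations of `η`, and both noises. -/
def history {n : ℕ} {H Ω : Type*} (e : ℕ → Ω → Vec n) (η : ℕ → Ω → H) (ξ ξ₀ : ℕ → Ω → ℝ)
    (k : ℕ) (ω : Ω) : Fin k → Vec n × H × ℝ × ℝ :=
  fun j => (e j ω, η j ω, ξ j ω, ξ₀ j ω)

/-- The randomness of the method and of the noisy two-point oracle.  At step `k` the direction `e k`
and the realisation `η k` are drawn, and the oracle returns `f(x + μ e; η) + ξ` and `f(x; η) + ξ₀`,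
with the same realisation `η k` in both answers.  The noises are bounded by `δ`, and each of them
does not depend on the direction that determines the query point; they may depend on `η k`, on each
other and on the past. -/
structure OracleModel {n : ℕ} {H Ω : Type*} [MeasurableSpace H] [MeasurableSpace Ω]
    (P : Measure Ω) (ν : Measure H) (δ : ℝ)
    (e : ℕ → Ω → Vec n) (η : ℕ → Ω → H) (ξ ξ₀ : ℕ → Ω → ℝ) : Prop where
  measurable_direction : ∀ k, Measurable (e k)
  measurable_realisation : ∀ k, Measurable (η k)
  measurable_noise : ∀ k, Measurable (ξ k)
  measurable_noise₀ : ∀ k, Measurable (ξ₀ k)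
  /-- Each direction is uniform on the Euclidean unit sphere. -/
  law_direction : ∀ k, P.map (e k) = uniformSphere n
  /-- Each realisation has the law `ν` of `η`. -/
  law_realisation : ∀ k, P.map (η k) = ν
  /-- The noise is bounded by `δ`. -/
  noise_le : ∀ k, ∀ᵐ ω ∂P, |ξ k ω| ≤ δ
  noise₀_le : ∀ k, ∀ᵐ ω ∂P, |ξ₀ k ω| ≤ δ
  /-- `η k` is drawn independently of the past. -/
  indep_realisation : ∀ k, IndepFun (η k) (history e η ξ ξ₀ k) P
  /-- `e k` is drawn independently of the past and of `η k`. -/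
  indep_direction : ∀ k, IndepFun (e k) (fun ω => (history e η ξ ξ₀ k ω, η k ω)) P
  /-- The noise at the shifted point is independent of the direction, given the past. -/
  indep_noise : ∀ k, IndepFun (e k) (fun ω => (history e η ξ ξ₀ k ω, ξ k ω)) P
  /-- The noise at the base point is independent of the direction, given the past. -/
  indep_noise₀ : ∀ k, IndepFun (e k) (fun ω => (history e η ξ ξ₀ k ω, ξ₀ k ω)) P

/-- The smoothing radius `min {max {ε/(2M₂), √(ε/L₂)}, (M₂/L₂)√(1/(6n))}`. -/
def smoothingRadius (n : ℕ) (ε M₂ L₂ : ℝ) : ℝ :=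
  min (max (ε / (2 * M₂)) (Real.sqrt (ε / L₂))) (M₂ / L₂ * Real.sqrt (1 / (6 * n)))

/-- The noisy gradient estimate
`(n/μ) (f(x + μ e; η) + ξ - (f(x; η) + ξ₀)) e`. -/
def gradEstimate {n : ℕ} {H : Type*} (f : Vec n → H → ℝ) (μ : ℝ) (x e : Vec n) (h : H)
    (ξ ξ₀ : ℝ) : Vec n :=
  ((n : ℝ) / μ * ((f (x + μ • e) h + ξ) - (f x h + ξ₀))) • e

/-- The point of the simplex with coordinates `exp (-sᵢ/β) / ∑ₗ exp (-sₗ/β)`. -/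
def mirror {n : ℕ} (β : ℝ) (s : Vec n) : Vec n :=
  WithLp.toLp 2 fun i => Real.exp (-(1 / β) * s i) / ∑ l, Real.exp (-(1 / β) * s l)

/-- The step parameter `β_t = M₂ √(5t)`. -/
def stepParam (M₂ : ℝ) (t : ℕ) : ℝ := M₂ * Real.sqrt (5 * t)

/-- The sum of the first `t` gradient estimates along the run of the method; the estimate number
`t + 1` is taken at the iterate `x^{t+1} = mirror β_{t+1} (sum of the first t estimates)`. -/
def estimateSum {n : ℕ} {H Ω : Type*} (f : Vec n → H → ℝ) (μ M₂ : ℝ)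
    (e : ℕ → Ω → Vec n) (η : ℕ → Ω → H) (ξ ξ₀ : ℕ → Ω → ℝ) (ω : Ω) : ℕ → Vec n
  | 0 => 0
  | t + 1 =>
      estimateSum f μ M₂ e η ξ ξ₀ ω t +
        gradEstimate f μ
          (mirror (stepParam M₂ (t + 1)) (estimateSum f μ M₂ e η ξ ξ₀ ω t))
          (e t ω) (η t ω) (ξ t ω) (ξ₀ t ω)

/-- The iterates, numbered from `0`: `iterate t` is `x^{t+1}`. -/
def iterate {n : ℕ} {H Ω : Type*} (f : Vec n → H → ℝ) (μ M₂ : ℝ)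
    (e : ℕ → Ω → Vec n) (η : ℕ → Ω → H) (ξ ξ₀ : ℕ → Ω → ℝ) (t : ℕ) (ω : Ω) : Vec n :=
  mirror (stepParam M₂ (t + 1)) (estimateSum f μ M₂ e η ξ ξ₀ ω t)

/-- The first iterate is the barycentre `(1/n, …, 1/n)`. -/
theorem iterate_zero {n : ℕ} {H Ω : Type*} (f : Vec n → H → ℝ) (μ M₂ : ℝ)
    (e : ℕ → Ω → Vec n) (η : ℕ → Ω → H) (ξ ξ₀ : ℕ → Ω → ℝ) (ω : Ω) (i : Fin n) :
    iterate f μ M₂ e η ξ ξ₀ 0 ω i = 1 / n := by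
  simp [iterate, mirror, estimateSum]

/-- The average `(1/N) ∑_{k=1}^N x^k` of the first `N` iterates. -/
def average {n : ℕ} {H Ω : Type*} (f : Vec n → H → ℝ) (μ M₂ : ℝ)
    (e : ℕ → Ω → Vec n) (η : ℕ → Ω → H) (ξ ξ₀ : ℕ → Ω → ℝ) (N : ℕ) (ω : Ω) : Vec n :=
  (1 / (N : ℝ)) • ∑ t ∈ Finset.range N, iterate f μ M₂ e η ξ ξ₀ t ω

/-- The number of iterations `⌈80 M₂² ln² n / ε²⌉`. -/
def iterationCount (n : ℕ) (ε M₂ : ℝ) : ℕ :=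
  ⌈80 * M₂ ^ 2 * Real.log n ^ 2 / ε ^ 2⌉₊

end GradientFree

end

/-!
Randomised smoothing reduces the two-point oracle to an ordinary stochastic gradient method. By
the divergence theorem on the unit ball, `(n/μ) E[f(x + μ e) e]` is the gradient at `x` of the
average `f_μ` of `f` over the ball of radius `μ` around `x`. Convexity gives `f ≤ f_μ`, and
`f_μ - f ≤ min (M₂ μ) (L₂ μ² / 2)` by either Lipschitz condition. The noises and the value
`f(x; η)` contribute nothing in expectation, because they are independent of `e` and `E[e] = 0`.

The second moment is where the two-point difference pays: `f(x + μ e; η) - f(x; η)` equals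
`μ ⟪∇f(x; η), e⟫` up to `L₂ μ² / 2`, and the symmetries of the sphere give
`E[⟪s, e⟫² ‖e‖_∞²] = ‖s‖² E[‖e‖_∞²] / n`. The moments of the coordinates of `e`, computed by the
divergence theorem once more, yield `n E[‖e‖_∞²] ≤ (5/2) log n`.
Hence `E[‖g‖_∞²] ≤ 5 M₂² log n`, and the regret bound of entropic dual averaging with
`β_t = M₂ √(5t)` leaves an error of `2 β_N log n / N ≤ ε / 2`, next to the bias, at most `ε / 2`.

No joint measurability of `f` is assumed. A McShane extension from a countable dense set replaces
`f` by a jointly measurable version that agrees with it on the whole neighbourhood for almost every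
`η`, so that the iterates are almost surely unchanged.
-/

noncomputable section

namespace GradientFree

open MeasureTheory ProbabilityTheory Set Metric Filter Topology

/-! ### The divergence theorem on the unit ball -/

section Cutoff

variable {E : Type*} [NormedAddCommGroup E]

/-- The radial function that is `1` on the unit ball, `0` outside the ball of radius `1 + s`, and
affine in `‖x‖` in between.  It serves as a Lipschitz approximation of the indicator of the unit
ball in the divergence theorem. -/
def cutoff (s : ℝ) (x : E) : ℝ := max 0 (min 1 ((1 + s - ‖x‖) / s))

theorem cutoff_of_norm_le {s : ℝ} (hs : 0 < s) {x : E} (hx : ‖x‖ ≤ 1) : cutoff s x = 1 := by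
  have : 1 ≤ (1 + s - ‖x‖) / s := by rw [le_div_iff₀ hs]; linarith
  rw [cutoff, min_eq_left this, max_eq_right zero_le_one]

theorem cutoff_of_le_norm {s : ℝ} (hs : 0 < s) {x : E} (hx : 1 + s ≤ ‖x‖) : cutoff s x = 0 := by
  have : (1 + s - ‖x‖) / s ≤ 0 := div_nonpos_of_nonpos_of_nonneg (by linarith) hs.le
  exact max_eq_left ((min_le_right _ _).trans this)

theorem cutoff_of_norm_mem_Ioo {s : ℝ} (hs : 0 < s) {x : E} (hx : ‖x‖ ∈ Ioo 1 (1 + s)) :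
    cutoff s x = (1 + s - ‖x‖) / s := by
  have h_nonneg : 0 ≤ (1 + s - ‖x‖) / s := div_nonneg (by linarith [hx.2]) hs.le
  have h_le_one : (1 + s - ‖x‖) / s ≤ 1 := by rw [div_le_one hs]; linarith [hx.1]
  rw [cutoff, min_eq_right h_le_one, max_eq_right h_nonneg]

theorem cutoff_mem_Icc (s : ℝ) (x : E) : cutoff s x ∈ Icc (0 : ℝ) 1 :=
  ⟨le_max_left _ _, max_le zero_le_one (min_le_left _ _)⟩

theorem lipschitzWith_cutoff {s : ℝ} (hs : 0 < s) :
    LipschitzWith (Real.toNNReal s⁻¹) (cutoff s : E → ℝ) := by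
  suffices LipschitzWith (Real.toNNReal s⁻¹) fun x : E => (1 + s - ‖x‖) / s from
    (this.const_min 1).const_max 0
  refine LipschitzWith.of_dist_le_mul fun x y => ?_
  rw [Real.coe_toNNReal _ (inv_nonneg.2 hs.le), Real.dist_eq, ← sub_div, abs_div, abs_of_pos hs,
    div_eq_inv_mul, dist_eq_norm, sub_sub_sub_cancel_left, abs_sub_comm]
  gcongr
  exact abs_norm_sub_norm_le x y

theorem hasCompactSupport_cutoff [ProperSpace E] {s : ℝ} (hs : 0 < s) :
    HasCompactSupport (cutoff s : E → ℝ) :=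
  .intro (isCompact_closedBall (0 : E) (1 + s)) fun x hx =>
    cutoff_of_le_norm hs (by simpa using (le_of_not_ge (by simpa using hx)))

variable [InnerProductSpace ℝ E]

theorem hasDerivAt_norm_add_smul {x : E} (hx : x ≠ 0) (v : E) :
    HasDerivAt (fun t : ℝ => ‖x + t • v‖) (inner ℝ (‖x‖⁻¹ • x) v) 0 := by
  have h_line : HasDerivAt (fun t : ℝ => x + t • v) v 0 := by
    simpa using ((hasDerivAt_id (0 : ℝ)).smul_const v).const_add x
  have h_sqrt := h_line.norm_sq.sqrt (by simpa using hx)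
  simp only [zero_smul, add_zero, Real.sqrt_sq (norm_nonneg _)] at h_sqrt
  convert h_sqrt using 1
  rw [real_inner_smul_left]
  field_simp

theorem lineDeriv_cutoff_neg {s : ℝ} (hs : 0 < s) (x v : E) (h1 : ‖x‖ ≠ 1) (h2 : ‖x‖ ≠ 1 + s) :
    lineDeriv ℝ (cutoff s) x (-v) =
      (ball 0 (1 + s) \ ball 0 1).indicator (fun y => s⁻¹ * inner ℝ (‖y‖⁻¹ • y) v) x := by
  have h_cont : ContinuousAt (fun t : ℝ => ‖x + t • (-v)‖) 0 := by fun_prop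
  have h_zero : ‖x + (0 : ℝ) • (-v)‖ = ‖x‖ := by simp
  have h_below {r : ℝ} (hr : ‖x‖ < r) : ∀ᶠ t in 𝓝 (0 : ℝ), ‖x + t • (-v)‖ < r :=
    h_cont.eventually_lt_const (h_zero.trans_lt hr)
  have h_above {r : ℝ} (hr : r < ‖x‖) : ∀ᶠ t in 𝓝 (0 : ℝ), r < ‖x + t • (-v)‖ :=
    h_cont.eventually_const_lt (hr.trans_eq h_zero.symm)
  rcases lt_or_gt_of_ne h1 with h_in | h_out
  · have h_const : (fun t : ℝ => cutoff s (x + t • (-v))) =ᶠ[𝓝 0] fun _ => 1 :=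
      (h_below h_in).mono fun t ht => cutoff_of_norm_le hs ht.le
    rw [lineDeriv, h_const.deriv_eq, deriv_const, indicator_of_notMem (by simp [h_in])]
  rcases lt_or_gt_of_ne h2 with h_shell | h_far
  · have h_affine : (fun t : ℝ => cutoff s (x + t • (-v))) =ᶠ[𝓝 0]
        fun t => (1 + s - ‖x + t • (-v)‖) / s := by
      filter_upwards [h_below h_shell, h_above h_out] with t ht ht'
      exact cutoff_of_norm_mem_Ioo hs ⟨ht', ht⟩
    have hx : x ≠ 0 := norm_pos_iff.1 (zero_lt_one.trans h_out)
    rw [lineDeriv, h_affine.deriv_eq,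
      (((hasDerivAt_norm_add_smul hx (-v)).const_sub (1 + s)).div_const s).deriv,
      indicator_of_mem (by simp [h_shell, h_out.le]), inner_neg_right, neg_neg, div_eq_inv_mul]
  · have h_const : (fun t : ℝ => cutoff s (x + t • (-v))) =ᶠ[𝓝 0] fun _ => 0 :=
      (h_above h_far).mono fun t ht => cutoff_of_le_norm hs ht.le
    rw [lineDeriv, h_const.deriv_eq, deriv_const, indicator_of_notMem (by simp [h_far.le])]

end Cutoff

section Sphere

variable {E : Type*} [NormedAddCommGroup E] [InnerProductSpace ℝ E] [FiniteDimensional ℝ E]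
  [MeasurableSpace E] [BorelSpace E]

theorem integrable_toSphere_of_continuous {G : E → ℝ} (hG : Continuous G) :
    Integrable (fun θ : sphere (0 : E) 1 => G θ) (volume : Measure E).toSphere :=
  (hG.comp continuous_subtype_val).integrable_of_hasCompactSupport
    (HasCompactSupport.of_compactSpace _)

theorem integrableOn_ball_of_continuous {G : E → ℝ} (hG : Continuous G) (R : ℝ) :
    IntegrableOn G (ball 0 R) :=
  (hG.continuousOn.integrableOn_compact (isCompact_closedBall 0 R)).mono_set
    ball_subset_closedBall

theorem continuous_integral_toSphere_smul {G : E → ℝ} (hG : Continuous G) :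
    Continuous fun r : ℝ => ∫ θ : sphere (0 : E) 1, G (r • θ) ∂(volume : Measure E).toSphere := by
  have h_joint : Continuous (Function.uncurry fun (r : ℝ) (θ : sphere (0 : E) 1) => G (r • θ)) := by
    fun_prop
  simpa only [setIntegral_univ] using
    continuous_parametric_integral_of_continuous h_joint isCompact_univ

variable [Nontrivial E]

theorem ae_norm_ne (r : ℝ) : ∀ᵐ x : E, ‖x‖ ≠ r := by
  have h_sphere : (volume : Measure E) (sphere 0 r) = 0 := Measure.addHaar_sphere _ 0 r
  simpa [ae_iff, sphere, dist_zero_right] using h_sphere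

theorem integral_volumeIoiPow (m : ℕ) (k : ℝ → ℝ) :
    ∫ r : Ioi (0 : ℝ), k r ∂.volumeIoiPow m = ∫ r in Ioi (0 : ℝ), r ^ m * k r := by
  simp only [Measure.volumeIoiPow, ENNReal.ofReal]
  rw [integral_withDensity_eq_integral_smul
    ((measurable_subtype_coe.pow_const _).real_toNNReal),
    integral_subtype_comap measurableSet_Ioi fun a => Real.toNNReal (a ^ m) • k a]
  refine setIntegral_congr_fun measurableSet_Ioi fun r hr => ?_
  rw [NNReal.smul_def, Real.coe_toNNReal _ (pow_nonneg (le_of_lt hr) _), smul_eq_mul]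

theorem integral_eq_integral_Ioi_toSphere {g : E → ℝ} (hg : Integrable g) :
    ∫ x, g x = ∫ r in Ioi (0 : ℝ), r ^ (Module.finrank ℝ E - 1) *
      ∫ θ : sphere (0 : E) 1, g (r • θ) ∂(volume : Measure E).toSphere := by
  let polar : sphere (0 : E) 1 × Ioi (0 : ℝ) → E := fun p => p.2.1 • p.1.1
  have h_mp := (volume : Measure E).measurePreserving_homeomorphUnitSphereProd
  have h_emb := (homeomorphUnitSphereProd E).measurableEmbedding
  have h_polar : ∀ x : ({0}ᶜ : Set E), polar (homeomorphUnitSphereProd E x) = x := fun x => by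
    simp [polar, smul_smul, mul_inv_cancel₀ (norm_ne_zero_iff.2 x.2)]
  have h_int : Integrable (g ∘ polar) ((volume : Measure E).toSphere.prod
      (.volumeIoiPow (Module.finrank ℝ E - 1))) := by
    rw [← h_mp.integrable_comp_emb h_emb]
    have := (MeasurableEmbedding.subtype_coe (measurableSet_singleton (0 : E)).compl
      |>.integrableOn_range_iff_comap (μ := volume) (f := g)).1 hg.integrableOn
    exact this.congr (ae_of_all _ fun x => congrArg g (h_polar x).symm)
  calc ∫ x, g x
      = ∫ x : ({0}ᶜ : Set E), g x ∂((volume : Measure E).comap Subtype.val) := by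
        rw [integral_subtype_comap (measurableSet_singleton _).compl, restrict_compl_singleton]
    _ = ∫ p, g (polar p) ∂(volume : Measure E).toSphere.prod
          (.volumeIoiPow (Module.finrank ℝ E - 1)) := by
        simp only [← h_mp.integral_comp h_emb, h_polar]
    _ = ∫ r : Ioi (0 : ℝ), ∫ θ : sphere (0 : E) 1, g (r.1 • θ.1)
          ∂(volume : Measure E).toSphere ∂.volumeIoiPow (Module.finrank ℝ E - 1) :=
        integral_prod_symm _ h_int
    _ = _ := integral_volumeIoiPow _
        fun r => ∫ θ : sphere (0 : E) 1, g (r • θ) ∂(volume : Measure E).toSphere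

theorem integral_ball_eq_intervalIntegral_toSphere {G : E → ℝ} (hG : Continuous G) {R : ℝ}
    (hR : 0 ≤ R) :
    ∫ x in ball (0 : E) R, G x = ∫ r in 0..R, r ^ (Module.finrank ℝ E - 1) *
      ∫ θ : sphere (0 : E) 1, G (r • θ) ∂(volume : Measure E).toSphere := by
  rw [← integral_indicator measurableSet_ball,
    integral_eq_integral_Ioi_toSphere
      ((integrable_indicator_iff measurableSet_ball).2 (integrableOn_ball_of_continuous hG R)),
    intervalIntegral.integral_of_le hR, integral_Ioc_eq_integral_Ioo, ← Ioi_inter_Iio,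
    ← setIntegral_indicator measurableSet_Iio]
  refine setIntegral_congr_fun measurableSet_Ioi fun r (hr : 0 < r) => ?_
  have h_norm : ∀ θ : sphere (0 : E) 1, ‖r • θ.1‖ = r := fun θ => by simp [norm_smul, abs_of_pos hr]
  by_cases h : r < R <;> simp [indicator, h_norm, h]

theorem hasDerivAt_integral_ball {G : E → ℝ} (hG : Continuous G) :
    HasDerivAt (fun R => ∫ x in ball (0 : E) R, G x)
      (∫ θ : sphere (0 : E) 1, G θ ∂(volume : Measure E).toSphere) 1 := by
  have h_cont : Continuous fun r : ℝ => r ^ (Module.finrank ℝ E - 1) *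
      ∫ θ : sphere (0 : E) 1, G (r • θ) ∂(volume : Measure E).toSphere :=
    (continuous_pow _).mul (continuous_integral_toSphere_smul hG)
  have h_ftc := intervalIntegral.integral_hasDerivAt_right (h_cont.intervalIntegrable 0 1)
    (h_cont.stronglyMeasurableAtFilter _ _) h_cont.continuousAt
  simp only [one_pow, one_mul, one_smul] at h_ftc
  refine h_ftc.congr_of_eventuallyEq ?_
  filter_upwards [lt_mem_nhds zero_lt_one] with R hR
  exact integral_ball_eq_intervalIntegral_toSphere hG (le_of_lt hR)

theorem integral_toSphere_comp_linearIsometryEquiv (T : E ≃ₗᵢ[ℝ] E) {G : E → ℝ}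
    (hG : Continuous G) :
    ∫ θ : sphere (0 : E) 1, G (T θ) ∂(volume : Measure E).toSphere =
      ∫ θ : sphere (0 : E) 1, G θ ∂(volume : Measure E).toSphere := by
  have h_ball (R : ℝ) : ∫ x in ball (0 : E) R, G (T x) = ∫ x in ball (0 : E) R, G x := by
    simpa [T.preimage_ball] using T.measurePreserving.setIntegral_preimage_emb
      T.toMeasurableEquiv.measurableEmbedding G (ball 0 R)
  have h_deriv := hasDerivAt_integral_ball (hG.comp T.continuous)
  simp only [Function.comp_apply, h_ball] at h_deriv
  exact h_deriv.unique (hasDerivAt_integral_ball hG)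

theorem integral_ball_of_homogeneous {G : E → ℝ} (hG : Continuous G) (j : ℕ)
    (h_hom : ∀ (r : ℝ) (x : E), G (r • x) = r ^ j * G x) :
    ∫ x in ball (0 : E) 1, G x = (∫ θ : sphere (0 : E) 1, G θ ∂(volume : Measure E).toSphere) /
      (Module.finrank ℝ E + j) := by
  have h_dim : ((Module.finrank ℝ E - 1 + j : ℕ) : ℝ) + 1 = Module.finrank ℝ E + j := by
    rw [Nat.cast_add, Nat.cast_pred Module.finrank_pos]; ring
  simp only [integral_ball_eq_intervalIntegral_toSphere hG zero_le_one, h_hom, integral_const_mul,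
    ← mul_assoc, ← pow_add, intervalIntegral.integral_mul_const, integral_pow, h_dim, one_pow,
    zero_pow (Nat.succ_ne_zero _), sub_zero]
  ring

theorem tendsto_integral_mul_cutoff {G : E → ℝ} (hG : AEStronglyMeasurable G) {M : ℝ}
    (hM : ∀ x, |G x| ≤ M) :
    Tendsto (fun s : ℝ => ∫ x, G x * cutoff s x) (𝓝[>] 0) (𝓝 (∫ x in ball (0 : E) 1, G x)) := by
  rw [← integral_indicator measurableSet_ball]
  refine tendsto_integral_filter_of_dominated_convergence
    ((closedBall (0 : E) 2).indicator fun _ => M) ?_ ?_ ?_ ?_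
  · filter_upwards [self_mem_nhdsWithin] with s hs
    exact hG.mul (lipschitzWith_cutoff hs).continuous.aestronglyMeasurable
  · filter_upwards [Ioo_mem_nhdsGT (zero_lt_one' ℝ)] with s hs
    refine ae_of_all _ fun x => ?_
    have ⟨h_nonneg, h_le_one⟩ := cutoff_mem_Icc s x
    by_cases hx : ‖x‖ ≤ 2
    · rw [indicator_of_mem (by simpa using hx), Real.norm_eq_abs, abs_mul, abs_of_nonneg h_nonneg]
      exact (mul_le_of_le_one_right (abs_nonneg _) h_le_one).trans (hM x)
    · rw [cutoff_of_le_norm hs.1 (by linarith [hs.2, not_le.1 hx]), mul_zero, norm_zero]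
      exact indicator_nonneg (fun _ _ => (abs_nonneg _).trans (hM x)) _
  · exact (integrable_indicator_iff measurableSet_closedBall).2
      (integrableOn_const measure_closedBall_lt_top.ne)
  · filter_upwards [ae_norm_ne (E := E) 1] with x hx
    rcases lt_or_gt_of_ne hx with h_in | h_out
    · rw [indicator_of_mem (by simpa using h_in)]
      refine tendsto_const_nhds.congr' ?_
      filter_upwards [self_mem_nhdsWithin] with s hs
      rw [cutoff_of_norm_le hs h_in.le, mul_one]
    · rw [indicator_of_notMem (by simpa using h_out.le)]
      refine tendsto_const_nhds.congr' ?_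
      filter_upwards [Ioo_mem_nhdsGT (sub_pos.2 h_out)] with s hs
      rw [cutoff_of_le_norm hs.1 (by linarith [hs.2]), mul_zero]

theorem integral_lineDeriv_mul_cutoff {F : E → ℝ} {C : NNReal} (hF : LipschitzWith C F) (v : E)
    {s : ℝ} (hs : 0 < s) :
    ∫ x, lineDeriv ℝ F x v * cutoff s x =
      s⁻¹ * ∫ x in ball 0 (1 + s) \ ball 0 1, F x * inner ℝ (‖x‖⁻¹ • x) v := by
  rw [hF.integral_lineDeriv_mul_eq (lipschitzWith_cutoff hs) (hasCompactSupport_cutoff hs),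
    ← integral_const_mul, ← integral_indicator (measurableSet_ball.diff measurableSet_ball)]
  refine integral_congr_ae ?_
  filter_upwards [ae_norm_ne (E := E) 1, ae_norm_ne (E := E) (1 + s)] with x h1 h2
  rw [lineDeriv_cutoff_neg hs x v h1 h2]
  by_cases hx : x ∈ ball (0 : E) (1 + s) \ ball 0 1
  · rw [indicator_of_mem hx, indicator_of_mem hx]; ring
  · rw [indicator_of_notMem hx, indicator_of_notMem hx, zero_mul]

/-- The derivative of `cutoff s` is `-s⁻¹` times the unit normal on the shell `1 ≤ ‖x‖ < 1 + s`, so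
integration by parts against `cutoff s` turns the surface integral into the difference quotient at
`R = 1` of an integral over the ball of radius `R`. -/
theorem integral_ball_lineDeriv {F : E → ℝ} {C : NNReal} (hF : LipschitzWith C F) (v : E) :
    ∫ x in ball (0 : E) 1, lineDeriv ℝ F x v =
      ∫ θ : sphere (0 : E) 1, F θ * inner ℝ (θ : E) v ∂(volume : Measure E).toSphere := by
  have h_ball := tendsto_integral_mul_cutoff (G := fun x => lineDeriv ℝ F x v)
    (aestronglyMeasurable_lineDeriv hF.continuous _) fun x => norm_lineDeriv_le_of_lipschitz ℝ hF
  let G : E → ℝ := fun x => F x * inner ℝ ((max 1 ‖x‖)⁻¹ • x) v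
  have hG : Continuous G := by
    have h_inv : Continuous fun x : E => (max 1 ‖x‖)⁻¹ :=
      (continuous_const.max continuous_norm).inv₀ fun x =>
        (zero_lt_one.trans_le (le_max_left _ _)).ne'
    exact hF.continuous.mul ((h_inv.smul continuous_id).inner continuous_const)
  have h_sphere := (hasDerivAt_integral_ball hG).tendsto_slope_zero_right
  have hG_sphere : ∀ θ : sphere (0 : E) 1, G θ = F θ * inner ℝ (θ : E) v := fun θ => by simp [G]
  simp only [hG_sphere] at h_sphere
  refine tendsto_nhds_unique h_ball (h_sphere.congr' ?_)
  filter_upwards [self_mem_nhdsWithin] with s (hs : 0 < s)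
  rw [integral_lineDeriv_mul_cutoff hF v hs, smul_eq_mul,
    ← setIntegral_sdiff measurableSet_ball
      (integrableOn_ball_of_continuous hG _) (ball_subset_ball (by linarith))]
  congr 1
  refine setIntegral_congr_fun (measurableSet_ball.diff measurableSet_ball) fun x hx => ?_
  have h_norm : max 1 ‖x‖ = ‖x‖ := max_eq_right (by simpa using hx.2)
  simp only [G, h_norm]

theorem integral_ball_of_hasLineDerivAt {F F' : E → ℝ} {C : NNReal}
    (hF : LipschitzOnWith C F (closedBall 0 1)) (v : E)
    (hF' : ∀ x ∈ ball (0 : E) 1, HasLineDerivAt ℝ F (F' x) x v) :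
    ∫ x in ball (0 : E) 1, F' x =
      ∫ θ : sphere (0 : E) 1, F θ * inner ℝ (θ : E) v ∂(volume : Measure E).toSphere := by
  obtain ⟨G, hG, hFG⟩ := hF.extend_real
  calc ∫ x in ball (0 : E) 1, F' x
      = ∫ x in ball (0 : E) 1, lineDeriv ℝ G x v := by
        refine setIntegral_congr_fun measurableSet_ball fun x hx => ?_
        have h_eq : F =ᶠ[𝓝 x] G := by
          filter_upwards [isOpen_ball.mem_nhds hx] with y hy
          exact hFG (ball_subset_closedBall hy)
        exact ((h_eq.hasLineDerivAt_iff).1 (hF' x hx)).lineDeriv.symm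
    _ = ∫ θ : sphere (0 : E) 1, G θ * inner ℝ (θ : E) v ∂(volume : Measure E).toSphere :=
        integral_ball_lineDeriv hG v
    _ = _ := by simp only [← hFG (sphere_subset_closedBall (Subtype.property _))]

end Sphere

section UniformSphere

variable {n : ℕ}

theorem integral_uniformSphere (g : Vec n → ℝ) :
    ∫ e, g e ∂uniformSphere n = (n * (volume : Measure (Vec n)).real (ball 0 1))⁻¹ *
      ∫ θ : sphere (0 : Vec n) 1, g θ ∂(volume : Measure (Vec n)).toSphere := by
  rw [uniformSphere, (MeasurableEmbedding.subtype_coe isClosed_sphere.measurableSet).integral_map,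
    integral_smul_measure]
  simp [Measure.real]

theorem ae_uniformSphere_norm_eq_one : ∀ᵐ e ∂uniformSphere n, ‖e‖ = 1 := by
  rw [uniformSphere, ae_map_iff measurable_subtype_coe.aemeasurable
    (measurableSet_eq_fun measurable_norm measurable_const)]
  exact ae_of_all _ norm_eq_of_mem_sphere

variable [NeZero n]

instance : Nontrivial (Vec n) :=
  ⟨EuclideanSpace.single 0 1, 0, fun h => by simpa using congrArg norm h⟩

theorem toSphere_univ_ne_zero : (volume : Measure (Vec n)).toSphere univ ≠ 0 := by
  rw [Measure.measure_univ_ne_zero]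
  exact Measure.toSphere_ne_zero _

instance isProbabilityMeasure_uniformSphere : IsProbabilityMeasure (uniformSphere n) where
  measure_univ := by
    rw [uniformSphere, Measure.map_apply measurable_subtype_coe .univ, preimage_univ,
      Measure.smul_apply, smul_eq_mul]
    exact ENNReal.inv_mul_cancel toSphere_univ_ne_zero (measure_lt_top _ _).ne

theorem integrable_uniformSphere_of_continuous {g : Vec n → ℝ} (hg : Continuous g) :
    Integrable g (uniformSphere n) := by
  rw [uniformSphere, (MeasurableEmbedding.subtype_coe
    isClosed_sphere.measurableSet).integrable_map_iff]
  exact (integrable_toSphere_of_continuous hg).smul_measure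
    (ENNReal.inv_ne_top.2 toSphere_univ_ne_zero)

theorem integral_uniformSphere_comp_linearIsometryEquiv (T : Vec n ≃ₗᵢ[ℝ] Vec n) {g : Vec n → ℝ}
    (hg : Continuous g) :
    ∫ e, g (T e) ∂uniformSphere n = ∫ e, g e ∂uniformSphere n := by
  rw [integral_uniformSphere, integral_uniformSphere,
    integral_toSphere_comp_linearIsometryEquiv T hg]

theorem integral_uniformSphere_inner (v : Vec n) : ∫ e, inner ℝ e v ∂uniformSphere n = 0 := by
  have h_neg := integral_uniformSphere_comp_linearIsometryEquiv (LinearIsometryEquiv.neg ℝ)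
    (continuous_id.inner (continuous_const (y := v)))
  simp only [id, LinearIsometryEquiv.coe_neg, inner_neg_left, integral_neg] at h_neg
  linarith

theorem average_ball_eq_integral_uniformSphere {F F' : Vec n → ℝ} {C : NNReal}
    (hF : LipschitzOnWith C F (closedBall 0 1)) (v : Vec n)
    (hF' : ∀ x ∈ ball (0 : Vec n) 1, HasLineDerivAt ℝ F (F' x) x v) :
    ⨍ x in ball (0 : Vec n) 1, F' x = n * ∫ e, F e * inner ℝ e v ∂uniformSphere n := by
  have hn : (n : ℝ) ≠ 0 := NeZero.ne _
  rw [setAverage_eq, integral_ball_of_hasLineDerivAt hF v hF', smul_eq_mul,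
    integral_uniformSphere fun e => F e * inner ℝ e v, mul_inv, mul_assoc, mul_inv_cancel_left₀ hn]

theorem average_ball_of_homogeneous {G : Vec n → ℝ} (hG : Continuous G) (j : ℕ)
    (h_hom : ∀ (r : ℝ) (x : Vec n), G (r • x) = r ^ j * G x) :
    ⨍ x in ball (0 : Vec n) 1, G x = n / (n + j) * ∫ e, G e ∂uniformSphere n := by
  have hn : (n : ℝ) ≠ 0 := NeZero.ne _
  rw [setAverage_eq, integral_ball_of_homogeneous hG j h_hom, smul_eq_mul, integral_uniformSphere,
    finrank_euclideanSpace_fin]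
  field_simp

theorem integral_uniformSphere_coord_pow_succ (i : Fin n) (p : ℕ) :
    ∫ e, e i ^ (2 * (p + 1)) ∂uniformSphere n =
      (2 * p + 1) / (n + 2 * p) * ∫ e, e i ^ (2 * p) ∂uniformSphere n := by
  have hn : (n : ℝ) ≠ 0 := NeZero.ne _
  have h_smooth : ContDiff ℝ 1 fun x : Vec n => x i ^ (2 * p + 1) := by fun_prop
  obtain ⟨C, hC⟩ := h_smooth.contDiffOn.exists_lipschitzOnWith one_ne_zero
    (convex_closedBall (0 : Vec n) 1) (isCompact_closedBall _ _)
  have h_lineDeriv (x : Vec n) : HasLineDerivAt ℝ (fun x : Vec n => x i ^ (2 * p + 1))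
      ((2 * p + 1) * x i ^ (2 * p)) x (EuclideanSpace.single i 1) := by
    have h_coord : HasDerivAt (fun t : ℝ => x i + t * 1) 1 0 := by
      simpa using (hasDerivAt_id (0 : ℝ)).const_add (x i)
    simpa [HasLineDerivAt] using h_coord.fun_pow (2 * p + 1)
  have h_parts := average_ball_eq_integral_uniformSphere hC _ fun x _ => h_lineDeriv x
  have h_hom := average_ball_of_homogeneous (G := fun x : Vec n => x i ^ (2 * p)) (by fun_prop)
    (2 * p) fun r x => by rw [PiLp.smul_apply, smul_eq_mul, mul_pow]
  rw [setAverage_eq, integral_const_mul, smul_eq_mul, mul_left_comm, ← smul_eq_mul _⁻¹,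
    ← setAverage_eq, h_hom] at h_parts
  have h_power (e : Vec n) : e i ^ (2 * p + 1) * inner ℝ e (EuclideanSpace.single i 1) =
      e i ^ (2 * (p + 1)) := by
    simp [EuclideanSpace.inner_single_right]; ring
  simp only [h_power] at h_parts
  rw [← mul_right_inj' hn, ← h_parts]
  push_cast
  ring

theorem integral_uniformSphere_coord_pow_le (i : Fin n) (p : ℕ) :
    ∫ e, e i ^ (2 * p) ∂uniformSphere n ≤ (∏ j ∈ Finset.range p, (2 * j + 1 : ℝ)) / n ^ p := by
  have hn : (0 : ℝ) < n := Nat.cast_pos.2 (NeZero.pos n)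
  induction p with
  | zero => simp
  | succ p ih =>
    rw [integral_uniformSphere_coord_pow_succ, Finset.prod_range_succ, pow_succ, mul_div_mul_comm,
      mul_comm]
    gcongr
    linarith [(Nat.cast_nonneg p : (0 : ℝ) ≤ p)]

theorem integral_uniformSphere_coord_pow_four (i : Fin n) :
    ∫ e, e i ^ (2 * 2) ∂uniformSphere n = 3 / (n * (n + 2)) := by
  have h_two := integral_uniformSphere_coord_pow_succ i 0
  have h_four := integral_uniformSphere_coord_pow_succ i 1
  norm_num at h_two h_four ⊢
  have hn : (n : ℝ) ≠ 0 := NeZero.ne _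
  rw [h_four, h_two]
  field_simp

end UniformSphere

section SupNorm

variable {ι : Type*} [Fintype ι]

/-- The norm `‖x‖_∞ = maxᵢ |xᵢ|` on a Euclidean space, which measures the gradient estimates. -/
def supNorm (x : EuclideanSpace ℝ ι) : ℝ := ‖WithLp.ofLp x‖

theorem continuous_supNorm : Continuous (supNorm : EuclideanSpace ℝ ι → ℝ) :=
  continuous_norm.comp (PiLp.continuous_ofLp 2 _)

theorem supNorm_nonneg (x : EuclideanSpace ℝ ι) : 0 ≤ supNorm x := norm_nonneg _

theorem supNorm_smul (c : ℝ) (x : EuclideanSpace ℝ ι) : supNorm (c • x) = |c| * supNorm x :=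
  norm_smul c (WithLp.ofLp x)

theorem abs_apply_le_supNorm (x : EuclideanSpace ℝ ι) (i : ι) : |x i| ≤ supNorm x :=
  norm_le_pi_norm (WithLp.ofLp x) i

theorem supNorm_le_iff {x : EuclideanSpace ℝ ι} {r : ℝ} (hr : 0 ≤ r) :
    supNorm x ≤ r ↔ ∀ i, |x i| ≤ r :=
  pi_norm_le_iff_of_nonneg hr

theorem supNorm_le_norm (x : EuclideanSpace ℝ ι) : supNorm x ≤ ‖x‖ :=
  (supNorm_le_iff (norm_nonneg x)).2 (PiLp.norm_apply_le x)

theorem supNorm_pow_le_sum [Nonempty ι] (x : EuclideanSpace ℝ ι) (p : ℕ) :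
    (supNorm x ^ 2) ^ p ≤ ∑ i, x i ^ (2 * p) := by
  obtain ⟨i, -, h_max⟩ :=
    Finset.exists_max_image Finset.univ (fun i => |x i|) Finset.univ_nonempty
  have h_eq : supNorm x = |x i| := le_antisymm
    ((supNorm_le_iff (abs_nonneg _)).2 fun j => h_max j (Finset.mem_univ j))
    (abs_apply_le_supNorm x i)
  rw [h_eq, sq_abs, ← pow_mul]
  exact Finset.single_le_sum (f := fun j => x j ^ (2 * p))
    (fun j _ => (even_two_mul p).pow_nonneg _) (Finset.mem_univ i)

theorem supNorm_eq_of_abs_apply_eq {x y : EuclideanSpace ℝ ι} (σ : Equiv.Perm ι)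
    (h : ∀ i, |x i| = |y (σ i)|) : supNorm x = supNorm y := by
  refine le_antisymm ((supNorm_le_iff (supNorm_nonneg y)).2 fun i => ?_)
    ((supNorm_le_iff (supNorm_nonneg x)).2 fun i => ?_)
  · exact (h i).trans_le (abs_apply_le_supNorm y _)
  · rw [← σ.apply_symm_apply i, ← h]
    exact abs_apply_le_supNorm x _

end SupNorm

/-! ### Moments of the uniform distribution on the sphere -/

section SupMoment

variable {n : ℕ}

/-- The second moment `E ‖e‖_∞²` of the maximum norm of a uniformly distributed direction. -/
def supMoment (n : ℕ) : ℝ := ∫ e, supNorm e ^ 2 ∂uniformSphere n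

theorem supMoment_nonneg : 0 ≤ supMoment n := integral_nonneg fun _ => sq_nonneg _

variable [NeZero n]

theorem supMoment_pow_le (p : ℕ) :
    supMoment n ^ p ≤ ∑ i, ∫ e, e i ^ (2 * p) ∂uniformSphere n := by
  have h_sq : Continuous fun e : Vec n => supNorm e ^ 2 := continuous_supNorm.pow 2
  have h_coord (i : Fin n) : Integrable (fun e : Vec n => e i ^ (2 * p)) (uniformSphere n) :=
    integrable_uniformSphere_of_continuous (by fun_prop)
  calc supMoment n ^ p
      ≤ ∫ e, (supNorm e ^ 2) ^ p ∂uniformSphere n :=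
        (convexOn_pow p).map_integral_le (by fun_prop) isClosed_Ici
          (ae_of_all _ fun e => sq_nonneg (supNorm e))
          (integrable_uniformSphere_of_continuous h_sq)
          (integrable_uniformSphere_of_continuous (h_sq.pow p))
    _ ≤ ∫ e, ∑ i, e i ^ (2 * p) ∂uniformSphere n :=
        integral_mono (integrable_uniformSphere_of_continuous (h_sq.pow p))
          (integrable_finsetSum _ fun i _ => h_coord i) fun e => supNorm_pow_le_sum e p
    _ = _ := integral_finsetSum _ fun i _ => h_coord i

theorem mul_supMoment_pow_le (p : ℕ) :
    (n * supMoment n) ^ p ≤ (∏ j ∈ Finset.range p, (2 * j + 1 : ℝ)) * n := by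
  have hn : (0 : ℝ) < n := Nat.cast_pos.2 (NeZero.pos n)
  calc (n * supMoment n) ^ p = n ^ p * supMoment n ^ p := mul_pow _ _ _
    _ ≤ n ^ p * ∑ _i : Fin n, (∏ j ∈ Finset.range p, (2 * j + 1 : ℝ)) / n ^ p := by
        gcongr
        exact (supMoment_pow_le p).trans
          (Finset.sum_le_sum fun i _ => integral_uniformSphere_coord_pow_le i p)
    _ = _ := by
        rw [Finset.sum_const, Finset.card_univ, Fintype.card_fin, nsmul_eq_mul]
        field_simp

theorem mul_supMoment_sq_le : (n * supMoment n) ^ 2 ≤ 3 * n ^ 2 / (n + 2) := by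
  have h_sq := supMoment_pow_le (n := n) 2
  simp only [integral_uniformSphere_coord_pow_four, Finset.sum_const, Finset.card_univ,
    Fintype.card_fin, nsmul_eq_mul] at h_sq
  have hn : (n : ℝ) ≠ 0 := NeZero.ne _
  calc (n * supMoment n) ^ 2 = n ^ 2 * supMoment n ^ 2 := mul_pow _ _ _
    _ ≤ n ^ 2 * (n * (3 / (n * (n + 2)))) := by gcongr
    _ = _ := by field_simp

theorem integral_coord_mul_coord_mul_supNorm_sq {i j : Fin n} (hij : i ≠ j) :
    ∫ e, e i * e j * supNorm e ^ 2 ∂uniformSphere n = 0 := by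
  let T : Vec n ≃ₗᵢ[ℝ] Vec n := LinearIsometryEquiv.piLpCongrRight 2
    fun k => if k = i then LinearIsometryEquiv.neg ℝ else LinearIsometryEquiv.refl ℝ ℝ
  have hT (e : Vec n) (k : Fin n) : T e k = if k = i then -e k else e k := by
    by_cases hk : k = i <;> simp [T, hk]
  have hT_supNorm (e : Vec n) : supNorm (T e) = supNorm e :=
    supNorm_eq_of_abs_apply_eq (Equiv.refl _) fun k => by rw [hT]; split_ifs <;> simp
  have h_reflect := integral_uniformSphere_comp_linearIsometryEquiv T
    (g := fun e => e i * e j * supNorm e ^ 2) (.mul (by fun_prop) (continuous_supNorm.pow 2))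
  simp only [hT_supNorm, hT, if_true, if_neg hij.symm, neg_mul, integral_neg] at h_reflect
  linarith

theorem integral_coord_sq_mul_supNorm_sq_congr (i j : Fin n) :
    ∫ e, e i ^ 2 * supNorm e ^ 2 ∂uniformSphere n =
      ∫ e, e j ^ 2 * supNorm e ^ 2 ∂uniformSphere n := by
  let T : Vec n ≃ₗᵢ[ℝ] Vec n := LinearIsometryEquiv.piLpCongrLeft 2 ℝ ℝ (Equiv.swap i j)
  have hT (e : Vec n) (k : Fin n) : T e k = e (Equiv.swap i j k) := by
    simp [T, LinearIsometryEquiv.piLpCongrLeft_apply, Equiv.piCongrLeft'_apply]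
  have hT_supNorm (e : Vec n) : supNorm (T e) = supNorm e :=
    supNorm_eq_of_abs_apply_eq (Equiv.swap i j) fun k => by rw [hT]
  have h_swap := integral_uniformSphere_comp_linearIsometryEquiv T
    (g := fun e => e j ^ 2 * supNorm e ^ 2) (.mul (by fun_prop) (continuous_supNorm.pow 2))
  simpa only [hT_supNorm, hT, Equiv.swap_apply_right] using h_swap

theorem integral_coord_sq_mul_supNorm_sq (i : Fin n) :
    ∫ e, e i ^ 2 * supNorm e ^ 2 ∂uniformSphere n = supMoment n / n := by
  have h_int (j : Fin n) :
      Integrable (fun e : Vec n => e j ^ 2 * supNorm e ^ 2) (uniformSphere n) :=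
    integrable_uniformSphere_of_continuous (.mul (by fun_prop) (continuous_supNorm.pow 2))
  rw [eq_div_iff (NeZero.ne _)]
  calc (∫ e, e i ^ 2 * supNorm e ^ 2 ∂uniformSphere n) * n
      = ∑ j : Fin n, ∫ e, e j ^ 2 * supNorm e ^ 2 ∂uniformSphere n := by
        rw [Finset.sum_congr rfl fun j _ => integral_coord_sq_mul_supNorm_sq_congr j i,
          Finset.sum_const, Finset.card_univ, Fintype.card_fin, nsmul_eq_mul, mul_comm]
    _ = ∫ e, ∑ j : Fin n, e j ^ 2 * supNorm e ^ 2 ∂uniformSphere n :=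
        (integral_finsetSum _ fun j _ => h_int j).symm
    _ = supMoment n := by
        refine integral_congr_ae ?_
        filter_upwards [ae_uniformSphere_norm_eq_one] with e he
        rw [← Finset.sum_mul, ← EuclideanSpace.real_norm_sq_eq, he, one_pow, one_mul]

theorem integral_inner_sq_mul_supNorm_sq (s : Vec n) :
    ∫ e, inner ℝ s e ^ 2 * supNorm e ^ 2 ∂uniformSphere n = ‖s‖ ^ 2 * (supMoment n / n) := by
  have h_expand (e : Vec n) : inner ℝ s e ^ 2 * supNorm e ^ 2 =
      ∑ i, ∑ j, s i * s j * (e i * e j * supNorm e ^ 2) := by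
    rw [PiLp.inner_apply, sq, Finset.sum_mul_sum, Finset.sum_mul]
    refine Finset.sum_congr rfl fun i _ => ?_
    rw [Finset.sum_mul]
    refine Finset.sum_congr rfl fun j _ => ?_
    simp only [RCLike.inner_apply, conj_trivial]
    ring
  have h_int (i j : Fin n) : Integrable (fun e : Vec n => s i * s j * (e i * e j * supNorm e ^ 2))
      (uniformSphere n) :=
    (integrable_uniformSphere_of_continuous
      (.mul (by fun_prop) (continuous_supNorm.pow 2))).const_mul _
  simp_rw [h_expand]
  rw [integral_finsetSum _ fun i _ => integrable_finsetSum _ fun j _ => h_int i j,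
    EuclideanSpace.real_norm_sq_eq, Finset.sum_mul]
  refine Finset.sum_congr rfl fun i _ => ?_
  rw [integral_finsetSum _ fun j _ => h_int i j, Finset.sum_eq_single_of_mem i (Finset.mem_univ i)]
  · simp_rw [integral_const_mul, ← sq, integral_coord_sq_mul_supNorm_sq]
  · intro j _ hj
    rw [integral_const_mul, integral_coord_mul_coord_mul_supNorm_sq hj.symm, mul_zero]

end SupMoment

section SupMomentLog

theorem exp_sub_le_div_pow {a b : ℝ} {k : ℕ} (ha : 0 < a) (hab : a ≤ b) (hbk : b ≤ k) :
    Real.exp (b - a) ≤ (b / a) ^ k := by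
  have hb : 0 < b := ha.trans_le hab
  have h_log : 1 - a / b ≤ Real.log (b / a) := by
    simpa using Real.one_sub_inv_le_log_of_pos (div_pos hb ha)
  have h_nonneg : 0 ≤ 1 - a / b := sub_nonneg.2 (div_le_one_of_le₀ hab hb.le)
  rw [← Real.le_log_iff_exp_le (by positivity), Real.log_pow]
  calc b - a = b * (1 - a / b) := by field_simp
    _ ≤ k * Real.log (b / a) := by gcongr

theorem exp_two_lt_eight : Real.exp 2 < 8 := by
  have h_sq : Real.exp 2 = Real.exp 1 ^ 2 := by rw [← Real.exp_nat_mul]; norm_num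
  rw [h_sq]
  nlinarith [Real.exp_one_lt_d9, Real.exp_pos 1]

theorem prod_odd_mul_exp_natCast_le {m : ℕ} (hm : 2 ≤ m) :
    (∏ j ∈ Finset.range (m + 1), (2 * j + 1 : ℝ)) * Real.exp m ≤ (5 / 2 * m) ^ (m + 1) := by
  induction m, hm using Nat.le_induction with
  | base =>
    norm_num [Finset.prod_range_succ]
    linarith [exp_two_lt_eight]
  | succ m hm ih =>
    have hm2 : (2 : ℝ) ≤ m := by exact_mod_cast hm
    have h_exp : Real.exp 1 ≤ ((m + 1) / m : ℝ) ^ (m + 1) := by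
      simpa using exp_sub_le_div_pow (b := m + 1) (k := m + 1) (by linarith : (0 : ℝ) < m)
        (by linarith) (by push_cast; rfl)
    rw [Finset.prod_range_succ, Nat.cast_succ, Real.exp_add]
    calc _ = ((∏ j ∈ Finset.range (m + 1), (2 * j + 1 : ℝ)) * Real.exp m) *
          ((2 * (m + 1) + 1) * Real.exp 1) := by ring
      _ ≤ (5 / 2 * m) ^ (m + 1) * (5 / 2 * (m + 1) * ((m + 1) / m : ℝ) ^ (m + 1)) := by
          gcongr
          linarith
      _ = (5 / 2 * (m + 1)) ^ (m + 1 + 1) := by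
          rw [div_pow, mul_pow, pow_succ (5 / 2 * (m + 1 : ℝ)), mul_pow]
          field_simp

theorem prod_odd_mul_exp_le {m : ℕ} (hm : 2 ≤ m) {l : ℝ} (h_ge : m ≤ l) (h_le : l ≤ m + 1) :
    (∏ j ∈ Finset.range (m + 1), (2 * j + 1 : ℝ)) * Real.exp l ≤ (5 / 2 * l) ^ (m + 1) := by
  have hm0 : (0 : ℝ) < m := by exact_mod_cast (by omega : 0 < m)
  calc _ = ((∏ j ∈ Finset.range (m + 1), (2 * j + 1 : ℝ)) * Real.exp m) * Real.exp (l - m) := by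
        rw [mul_assoc, ← Real.exp_add, add_sub_cancel]
    _ ≤ (5 / 2 * m) ^ (m + 1) * (l / m) ^ (m + 1) := by
        gcongr
        · exact prod_odd_mul_exp_natCast_le hm
        · exact exp_sub_le_div_pow hm0 h_ge (by exact_mod_cast h_le)
    _ = _ := by rw [← mul_pow]; congr 1; field_simp

theorem three_mul_sq_le_log {n : ℕ} (h2 : 2 ≤ n) (h7 : n ≤ 7) :
    3 * (n : ℝ) ^ 2 ≤ (5 / 2 * Real.log n) ^ 2 * (n + 2) := by
  have log_two := Real.log_two_gt_d9
  have log_three : 1 ≤ Real.log 3 := by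
    rw [Real.le_log_iff_exp_le (by norm_num)]; linarith [Real.exp_one_lt_d9]
  have log_four : Real.log 4 = 2 * Real.log 2 := by
    rw [show (4 : ℝ) = 2 ^ 2 by norm_num, Real.log_pow]; norm_num
  have log_five : Real.log 4 ≤ Real.log 5 := Real.log_le_log (by norm_num) (by norm_num)
  have log_six : Real.log 6 = Real.log 2 + Real.log 3 := by
    rw [← Real.log_mul (by norm_num) (by norm_num)]; norm_num
  have log_seven : Real.log 6 ≤ Real.log 7 := Real.log_le_log (by norm_num) (by norm_num)
  interval_cases n <;> push_cast <;> nlinarith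

/-- With `p = 2` the exact fourth moment suffices for `n ≤ 7`; beyond that the moment of order
`p = ⌊log n⌋ + 1` is used, for which `n ^ (1 / p)` is bounded. -/
theorem mul_supMoment_le {n : ℕ} (hn : 2 ≤ n) : n * supMoment n ≤ 5 / 2 * Real.log n := by
  have : NeZero n := ⟨by omega⟩
  have hn0 : (0 : ℝ) < n := by exact_mod_cast (by omega : 0 < n)
  have h_log : 0 ≤ Real.log n := Real.log_natCast_nonneg n
  rcases le_or_gt n 7 with h_small | h_large
  · refine le_of_sq_le_sq (mul_supMoment_sq_le.trans ?_) (by positivity)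
    exact div_le_of_le_mul₀ (by positivity) (sq_nonneg _) (three_mul_sq_le_log hn h_small)
  · have h_log_two : 2 ≤ Real.log n := by
      rw [Real.le_log_iff_exp_le hn0]
      exact exp_two_lt_eight.le.trans (by exact_mod_cast h_large)
    have h_prod := prod_odd_mul_exp_le (Nat.le_floor (by exact_mod_cast h_log_two))
      (Nat.floor_le h_log) (Nat.lt_floor_add_one _).le
    rw [Real.exp_log hn0] at h_prod
    exact le_of_pow_le_pow_left₀ (Nat.succ_ne_zero _) (by positivity)
      ((mul_supMoment_pow_le _).trans h_prod)

end SupMomentLog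

/-! ### Entropic dual averaging -/

section Entropy

theorem sum_mul_exp_le_exp_sum {ι : Type*} [Fintype ι] {p a : ι → ℝ} {l u : ℝ}
    (hp : p ∈ stdSimplex ℝ ι) (ha : ∀ i, a i ∈ Icc l u) :
    ∑ i, p i * Real.exp (a i) ≤ Real.exp (∑ i, p i * a i + (u - l) ^ 2 / 8) := by
  let : MeasurableSpace ι := ⊤
  let m : Measure ι := ∑ i, ENNReal.ofReal (p i) • Measure.dirac i
  have h_integral (φ : ι → ℝ) : ∫ i, φ i ∂m = ∑ i, p i * φ i := by
    rw [integral_finsetSum_measure fun i _ =>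
      (integrable_dirac (by simp)).smul_measure ENNReal.ofReal_ne_top]
    simp [integral_smul_measure, ENNReal.toReal_ofReal (hp.1 _)]
  have : IsProbabilityMeasure m := ⟨by
    simp [m, ← ENNReal.ofReal_sum_of_nonneg fun i _ => hp.1 i, hp.2]⟩
  have h_hoeffding := (hasSubgaussianMGF_of_mem_Icc (μ := m) (X := a)
    measurable_from_top.aemeasurable (ae_of_all _ ha)).mgf_le 1
  simp only [mgf, h_integral, one_mul, Real.exp_sub, mul_div_assoc', ← Finset.sum_div,
    div_le_iff₀ (Real.exp_pos _), ← Real.exp_add] at h_hoeffding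
  refine h_hoeffding.trans_eq (congrArg Real.exp ?_)
  push_cast
  rw [div_pow, Real.norm_eq_abs, sq_abs]
  ring

variable {n : ℕ}

theorem sum_mul_const_mul_eq_inner (c : ℝ) (s u : Vec n) :
    ∑ i, u i * (c * s i) = c * inner ℝ s u := by
  simp only [PiLp.inner_apply, Finset.mul_sum, RCLike.inner_apply, conj_trivial, mul_left_comm]

theorem sum_mirror_mul_exp (β : ℝ) (s g : Vec n) :
    ∑ i, mirror β s i * Real.exp (-(1 / β) * g i) =
      (∑ i, Real.exp (-(1 / β) * (s + g) i)) / ∑ i, Real.exp (-(1 / β) * s i) := by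
  simp only [mirror, div_mul_eq_mul_div, ← Finset.sum_div, ← Real.exp_add, ← mul_add,
    PiLp.add_apply]

/-- The dual potential `β log (n⁻¹ ∑ᵢ exp (-sᵢ/β))`: the convex conjugate, taken at `-s`, of the
entropy on the simplex with parameter `β`.  Its gradient in `s` is `-mirror β s`. -/
def potential (β : ℝ) (s : Vec n) : ℝ :=
  β * Real.log ((1 / n) * ∑ i, Real.exp (-(1 / β) * s i))

variable [NeZero n]

theorem sum_exp_pos (β : ℝ) (s : Vec n) : 0 < ∑ i, Real.exp (-(1 / β) * s i) :=
  Finset.sum_pos (fun _ _ => Real.exp_pos _) Finset.univ_nonempty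

theorem mirror_mem_simplex (β : ℝ) (s : Vec n) : mirror β s ∈ simplex n := by
  refine ⟨fun i => div_nonneg (Real.exp_pos _).le (sum_exp_pos β s).le, ?_⟩
  simp only [mirror]
  rw [← Finset.sum_div, div_self (sum_exp_pos β s).ne']

theorem potential_eq_log_sub (β : ℝ) (s : Vec n) :
    potential β s = β * Real.log (∑ i, Real.exp (-(1 / β) * s i)) - β * Real.log n := by
  rw [potential, Real.log_mul (one_div_ne_zero (NeZero.ne _)) (sum_exp_pos β s).ne', one_div,
    Real.log_inv]
  ring

theorem potential_zero (β : ℝ) : potential β (0 : Vec n) = 0 := by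
  simp [potential_eq_log_sub]

theorem potential_add_le {β : ℝ} (hβ : 0 < β) (s g : Vec n) :
    potential β (s + g) ≤ potential β s - inner ℝ g (mirror β s) + supNorm g ^ 2 / (2 * β) := by
  have h_bound (i : Fin n) : -(1 / β) * g i ∈ Icc (-(supNorm g / β)) (supNorm g / β) := by
    rw [mem_Icc, ← abs_le, abs_mul, abs_neg, abs_of_pos (by positivity), one_div_mul_eq_div]
    exact div_le_div_of_nonneg_right (abs_apply_le_supNorm g i) hβ.le
  have h_hoeffding := sum_mul_exp_le_exp_sum (mirror_mem_simplex β s) h_bound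
  rw [sum_mirror_mul_exp, sum_mul_const_mul_eq_inner,
    ← Real.log_le_iff_le_exp (div_pos (sum_exp_pos β _) (sum_exp_pos β _)),
    Real.log_div (sum_exp_pos β _).ne' (sum_exp_pos β _).ne'] at h_hoeffding
  rw [potential_eq_log_sub, potential_eq_log_sub]
  calc _ = β * (Real.log (∑ i, Real.exp (-(1 / β) * (s + g) i)) -
          Real.log (∑ i, Real.exp (-(1 / β) * s i))) +
        (β * Real.log (∑ i, Real.exp (-(1 / β) * s i)) - β * Real.log n) := by ring
    _ ≤ β * (-(1 / β) * inner ℝ g (mirror β s) + (supNorm g / β - -(supNorm g / β)) ^ 2 / 8) +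
        (β * Real.log (∑ i, Real.exp (-(1 / β) * s i)) - β * Real.log n) := by gcongr
    _ = _ := by field_simp; ring

theorem potential_anti {β β' : ℝ} (hβ : 0 < β) (h : β ≤ β') (s : Vec n) :
    potential β' s ≤ potential β s := by
  have hn : (n : ℝ) ≠ 0 := NeZero.ne _
  have hβ' : 0 < β' := hβ.trans_le h
  have h_pow (i : Fin n) :
      Real.exp (-(1 / β') * s i) ^ (β' / β) = Real.exp (-(1 / β) * s i) := by
    rw [← Real.exp_mul]; congr 1; field_simp
  have h_mean := Real.rpow_arith_mean_le_arith_mean_rpow Finset.univ (fun _ : Fin n => (1 / n : ℝ))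
    (fun i => Real.exp (-(1 / β') * s i)) (fun _ _ => by positivity) (by simp [hn])
    (fun _ _ => (Real.exp_pos _).le) ((one_le_div hβ).2 h)
  simp only [h_pow, ← Finset.mul_sum] at h_mean
  have h_pos : 0 < 1 / n * ∑ i, Real.exp (-(1 / β') * s i) :=
    mul_pos (by positivity) (sum_exp_pos β' s)
  calc potential β' s
      = β * (β' / β * Real.log (1 / n * ∑ i, Real.exp (-(1 / β') * s i))) := by
        rw [potential]; field_simp
    _ = β * Real.log ((1 / n * ∑ i, Real.exp (-(1 / β') * s i)) ^ (β' / β)) := by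
        rw [Real.log_rpow h_pos]
    _ ≤ potential β s := by unfold potential; gcongr

theorem neg_inner_sub_le_potential {β : ℝ} (hβ : 0 < β) (s : Vec n) {u : Vec n}
    (hu : u ∈ simplex n) : -inner ℝ s u - β * Real.log n ≤ potential β s := by
  have h_le (i : Fin n) : -(1 / β) * s i ≤ Real.log (∑ i, Real.exp (-(1 / β) * s i)) := by
    rw [Real.le_log_iff_exp_le (sum_exp_pos β s)]
    exact Finset.single_le_sum (f := fun i => Real.exp (-(1 / β) * s i))
      (fun j _ => (Real.exp_pos _).le) (Finset.mem_univ i)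
  have h_mean : -(1 / β) * inner ℝ s u ≤ Real.log (∑ i, Real.exp (-(1 / β) * s i)) := by
    rw [← sum_mul_const_mul_eq_inner]
    calc _ ≤ ∑ i, u i * Real.log (∑ i, Real.exp (-(1 / β) * s i)) :=
          Finset.sum_le_sum fun i _ => mul_le_mul_of_nonneg_left (h_le i) (hu.1 i)
      _ = _ := by rw [← Finset.sum_mul, hu.2, one_mul]
  rw [potential_eq_log_sub]
  calc _ = β * (-(1 / β) * inner ℝ s u) - β * Real.log n := by field_simp
    _ ≤ _ := by gcongr

theorem potential_sum_le (g : ℕ → Vec n) {β : ℕ → ℝ} (hβ : ∀ t, 0 < β t) (h_mono : Monotone β)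
    (t : ℕ) :
    potential (β t) (∑ k ∈ Finset.range t, g k) ≤ ∑ k ∈ Finset.range t,
      (supNorm (g k) ^ 2 / (2 * β k) -
        inner ℝ (g k) (mirror (β k) (∑ j ∈ Finset.range k, g j))) := by
  induction t with
  | zero => simp [potential_zero]
  | succ t ih =>
    rw [Finset.sum_range_succ, Finset.sum_range_succ]
    have h_anti := potential_anti (hβ t) (h_mono t.le_succ) (∑ k ∈ Finset.range t, g k + g t)
    have h_step := potential_add_le (hβ t) (∑ k ∈ Finset.range t, g k) (g t)
    linarith

theorem dualAveraging_regret_le (g : ℕ → Vec n) {β : ℕ → ℝ} (hβ : ∀ t, 0 < β t)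
    (h_mono : Monotone β) {u : Vec n} (hu : u ∈ simplex n) (N : ℕ) :
    ∑ t ∈ Finset.range (N + 1), inner ℝ (g t) (mirror (β t) (∑ k ∈ Finset.range t, g k) - u) ≤
      β N * Real.log n + ∑ t ∈ Finset.range (N + 1), supNorm (g t) ^ 2 / (2 * β t) := by
  have h_upper := potential_sum_le g hβ h_mono N
  have h_last := potential_add_le (hβ N) (∑ k ∈ Finset.range N, g k) (g N)
  have h_lower := neg_inner_sub_le_potential (hβ N) (∑ k ∈ Finset.range (N + 1), g k) hu
  rw [← Finset.sum_range_succ] at h_last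
  rw [sum_inner] at h_lower
  rw [Finset.sum_sub_distrib] at h_upper
  simp only [inner_sub_right, Finset.sum_sub_distrib]
  rw [Finset.sum_range_succ fun k => inner ℝ (g k) (mirror (β k) (∑ j ∈ Finset.range k, g j)),
    Finset.sum_range_succ fun k => supNorm (g k) ^ 2 / (2 * β k)]
  linarith

end Entropy

section NormBounds

variable {E F : Type*} [SeminormedAddCommGroup E] [SeminormedAddCommGroup F] {S : Set E}
  {g : E → F} {C : ℝ}

theorem lipschitzOnWith_of_norm_sub_le (h : ∀ x ∈ S, ∀ y ∈ S, ‖g x - g y‖ ≤ C * ‖x - y‖) :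
    LipschitzOnWith C.toNNReal g S :=
  LipschitzOnWith.of_dist_le' fun x hx y hy => by
    simpa only [dist_eq_norm] using h x hx y hy

theorem nonneg_of_norm_sub_le (h : ∀ x ∈ S, ∀ y ∈ S, ‖g x - g y‖ ≤ C * ‖x - y‖) {x y : E}
    (hx : x ∈ S) (hy : y ∈ S) (hxy : 0 < ‖x - y‖) : 0 ≤ C :=
  nonneg_of_mul_nonneg_left ((norm_nonneg _).trans (h x hx y hy)) hxy

end NormBounds

-- The weight `7 / 5` on the gradient leaves a factor `7` for the two remainders, which is what the
-- smoothing radius and the noise level of the theorem can afford.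
theorem add_add_sq_le (b l d : ℝ) :
    (b + l + d) ^ 2 ≤ 7 / 5 * b ^ 2 + 7 * (l ^ 2 + d ^ 2) := by
  nlinarith [sq_nonneg (2 / 5 * b - (l + d)), sq_nonneg (l - d)]

/-! ### Ball averages of smooth convex functions -/

section SmoothConvexOn

variable {E : Type*} [NormedAddCommGroup E] [InnerProductSpace ℝ E]

theorem add_smul_mem_ball_iff {μ : ℝ} (hμ : 0 < μ) {x u : E} :
    x + μ • u ∈ ball x μ ↔ u ∈ ball (0 : E) 1 := by
  rw [mem_ball_iff_norm, add_sub_cancel_left, norm_smul, Real.norm_of_nonneg hμ.le,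
    mem_ball_zero_iff, mul_lt_iff_lt_one_right hμ]

theorem add_smul_mem_closedBall_iff {μ : ℝ} (hμ : 0 < μ) {x u : E} :
    x + μ • u ∈ closedBall x μ ↔ u ∈ closedBall (0 : E) 1 := by
  rw [mem_closedBall_iff_norm, add_sub_cancel_left, norm_smul, Real.norm_of_nonneg hμ.le,
    mem_closedBall_zero_iff, mul_le_iff_le_one_right hμ]

variable [CompleteSpace E]

/-- `φ` is convex and `K`-Lipschitz on `D`, and differentiable with `L`-Lipschitz gradient on the
open subset `U` of `D`.  The gradient is kept on a smaller set than the function because in the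
setting of the theorem the values are given up to the boundary of a neighbourhood and the gradients
only inside it. -/
structure SmoothConvexOn (U D : Set E) (φ : E → ℝ) (K L : ℝ) : Prop where
  isOpen : IsOpen U
  subset : U ⊆ D
  convexOn : ConvexOn ℝ D φ
  abs_sub_le : ∀ x ∈ D, ∀ y ∈ D, |φ x - φ y| ≤ K * ‖x - y‖
  differentiableAt : ∀ x ∈ U, DifferentiableAt ℝ φ x
  norm_gradient_sub_le : ∀ x ∈ U, ∀ y ∈ U, ‖gradient φ x - gradient φ y‖ ≤ L * ‖x - y‖

namespace SmoothConvexOn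

variable {U D : Set E} {φ : E → ℝ} {K L : ℝ} {x : E}

theorem continuousOn (h : SmoothConvexOn U D φ K L) : ContinuousOn φ D :=
  (lipschitzOnWith_of_norm_sub_le h.abs_sub_le).continuousOn

theorem continuousOn_gradient (h : SmoothConvexOn U D φ K L) : ContinuousOn (gradient φ) U :=
  (lipschitzOnWith_of_norm_sub_le h.norm_gradient_sub_le).continuousOn

theorem hasLineDerivAt (h : SmoothConvexOn U D φ K L) (hx : x ∈ U) (v : E) :
    HasLineDerivAt ℝ φ (inner ℝ (gradient φ x) v) x v := by
  simpa using (h.differentiableAt x hx).hasGradientAt.hasFDerivAt.hasLineDerivAt v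

theorem hasDerivAt_line (h : SmoothConvexOn U D φ K L) {v : E} {t : ℝ} (ht : x + t • v ∈ U) :
    HasDerivAt (fun s : ℝ => φ (x + s • v)) (inner ℝ (gradient φ (x + t • v)) v) t := by
  have h_line : HasDerivAt (fun s : ℝ => x + s • v) v t := by
    simpa only [id, one_smul] using ((hasDerivAt_id t).smul_const v).const_add x
  simpa [Function.comp_def] using
    (h.differentiableAt _ ht).hasGradientAt.hasFDerivAt.comp_hasDerivAt t h_line

theorem add_inner_gradient_le (h : SmoothConvexOn U D φ K L) (hx : x ∈ U) {y : E} (hy : y ∈ D) :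
    φ x + inner ℝ (gradient φ x) (y - x) ≤ φ y := by
  have h_conv := h.convexOn.comp_affineMap (AffineMap.lineMap (k := ℝ) x y)
  have h_deriv : HasDerivAt (φ ∘ AffineMap.lineMap (k := ℝ) x y)
      (inner ℝ (gradient φ x) (y - x)) 0 := by
    simpa [HasLineDerivAt, Function.comp_def, AffineMap.lineMap_apply, add_comm] using
      h.hasLineDerivAt hx (y - x)
  have h_slope := h_conv.le_slope_of_hasDerivAt (x := 0) (y := 1)
    (by simpa using h.subset hx) (by simpa using hy) one_pos h_deriv
  simp only [slope_def_field, Function.comp_apply, AffineMap.lineMap_apply_one,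
    AffineMap.lineMap_apply_zero, sub_zero, div_one] at h_slope
  linarith

theorem abs_sub_linear_le (h : SmoothConvexOn U D φ K L) {u : E}
    (hU : ∀ t ∈ Ico (0 : ℝ) 1, x + t • u ∈ U) (hD : x + u ∈ D) :
    |φ (x + u) - φ x - inner ℝ (gradient φ x) u| ≤ L / 2 * ‖u‖ ^ 2 := by
  let w : ℝ → ℝ := fun t => φ (x + t • u) - φ x - t * inner ℝ (gradient φ x) u
  let w' : ℝ → ℝ := fun t => inner ℝ (gradient φ (x + t • u)) u - inner ℝ (gradient φ x) u
  have hx : x ∈ U := by simpa using hU 0 ⟨le_rfl, one_pos⟩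
  have h_mem : ∀ t ∈ Icc (0 : ℝ) 1, x + t • u ∈ D := fun t ht => by
    rcases ht.2.eq_or_lt with rfl | ht1
    · rwa [one_smul]
    · exact h.subset (hU t ⟨ht.1, ht1⟩)
  have h_cont : ContinuousOn w (Icc 0 1) :=
    ((h.continuousOn.comp (by fun_prop) h_mem).sub continuousOn_const).sub (by fun_prop)
  have hw : ∀ t ∈ Ico (0 : ℝ) 1, HasDerivAt w (w' t) t := fun t ht => by
    simpa [w, w'] using ((h.hasDerivAt_line (hU t ht)).sub_const (φ x)).fun_sub
      ((hasDerivAt_id t).mul_const (inner ℝ (gradient φ x) u))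
  have hw' : ∀ t ∈ Ico (0 : ℝ) 1, ‖w' t‖ ≤ L * ‖u‖ ^ 2 * t := fun t ht => by
    have h_lip := h.norm_gradient_sub_le _ (hU t ht) _ hx
    rw [add_sub_cancel_left, norm_smul, Real.norm_of_nonneg ht.1] at h_lip
    calc ‖w' t‖ = ‖inner ℝ (gradient φ (x + t • u) - gradient φ x) u‖ := by rw [inner_sub_left]
      _ ≤ ‖gradient φ (x + t • u) - gradient φ x‖ * ‖u‖ := norm_inner_le_norm _ _
      _ ≤ L * (t * ‖u‖) * ‖u‖ := by gcongr
      _ = L * ‖u‖ ^ 2 * t := by ring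
  have h_bound : ∀ t : ℝ, HasDerivAt (fun t => L / 2 * ‖u‖ ^ 2 * t ^ 2) (L * ‖u‖ ^ 2 * t) t :=
    fun t => ((hasDerivAt_pow 2 t).const_mul (L / 2 * ‖u‖ ^ 2)).congr_deriv (by push_cast; ring)
  have h_one := image_norm_le_of_norm_deriv_right_le_deriv_boundary h_cont
    (fun t ht => (hw t ht).hasDerivWithinAt) (by simp [w]) h_bound hw' (right_mem_Icc.2 zero_le_one)
  simpa [w] using h_one

variable {μ : ℝ}

theorem lipschitzOnWith_add_smul (h : SmoothConvexOn U D φ K L) (hD : closedBall x μ ⊆ D)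
    (hμ : 0 < μ) :
    LipschitzOnWith (K * μ).toNNReal (fun u => φ (x + μ • u)) (closedBall (0 : E) 1) := by
  refine lipschitzOnWith_of_norm_sub_le fun u hu w hw => ?_
  have h_lip := h.abs_sub_le _ (hD ((add_smul_mem_closedBall_iff hμ).2 hu))
    _ (hD ((add_smul_mem_closedBall_iff hμ).2 hw))
  rwa [add_sub_add_left_eq_sub, ← smul_sub, norm_smul, Real.norm_of_nonneg hμ.le,
    ← mul_assoc] at h_lip

theorem abs_sub_linear_le_of_mem_closedBall (h : SmoothConvexOn U D φ K L)
    (hU : ball x μ ⊆ U) (hD : closedBall x μ ⊆ D) (hμ : 0 < μ) {u : E}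
    (hu : ‖u‖ ≤ μ) : |φ (x + u) - φ x - inner ℝ (gradient φ x) u| ≤ L / 2 * ‖u‖ ^ 2 := by
  refine h.abs_sub_linear_le (fun t ht => hU ?_) (hD (by simpa using hu))
  rw [mem_ball_iff_norm, add_sub_cancel_left, norm_smul, Real.norm_of_nonneg ht.1]
  nlinarith [ht.1, ht.2]

theorem sq_abs_sub_add_le (h : SmoothConvexOn U D φ K L) (hU : ball x μ ⊆ U)
    (hD : closedBall x μ ⊆ D) (hμ : 0 < μ) {δ : ℝ} (hδ : 0 ≤ δ) {e : E} (he : ‖e‖ = 1) :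
    (|φ (x + μ • e) - φ x| + 2 * δ) ^ 2 ≤ μ ^ 2 * (7 / 5 * inner ℝ (gradient φ x) e ^ 2 +
      7 * (L ^ 2 * μ ^ 2 / 4 + 4 * δ ^ 2 / μ ^ 2)) := by
  have h_norm : ‖μ • e‖ = μ := by rw [norm_smul, he, mul_one, Real.norm_of_nonneg hμ.le]
  have h_taylor := h.abs_sub_linear_le_of_mem_closedBall hU hD hμ h_norm.le
  rw [h_norm, inner_smul_right] at h_taylor
  set b := inner ℝ (gradient φ x) e
  have h_abs : |φ (x + μ • e) - φ x| ≤ |μ * b| + L / 2 * μ ^ 2 := by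
    linarith [abs_sub_abs_le_abs_sub (φ (x + μ • e) - φ x) (μ * b)]
  calc (|φ (x + μ • e) - φ x| + 2 * δ) ^ 2
      ≤ (|μ * b| + L / 2 * μ ^ 2 + 2 * δ) ^ 2 := by gcongr
    _ ≤ 7 / 5 * (μ * b) ^ 2 + 7 * ((L / 2 * μ ^ 2) ^ 2 + (2 * δ) ^ 2) := by
        rw [← sq_abs (μ * b)]
        exact add_add_sq_le _ _ _
    _ = μ ^ 2 * (7 / 5 * b ^ 2 + 7 * (L ^ 2 * μ ^ 2 / 4 + 4 * δ ^ 2 / μ ^ 2)) := by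
        field_simp
        ring

theorem le_symmetric_mean (h : SmoothConvexOn U D φ K L) {w : E} (h_add : x + w ∈ D)
    (h_sub : x - w ∈ D) : φ x ≤ (φ (x + w) + φ (x - w)) / 2 := by
  obtain ⟨-, h_conv⟩ := h.convexOn
  have h_mid := h_conv h_add h_sub (a := 1 / 2) (b := 1 / 2) (by norm_num) (by norm_num)
    (by norm_num)
  rw [show (1 / 2 : ℝ) • (x + w) + (1 / 2 : ℝ) • (x - w) = x by module] at h_mid
  simp only [smul_eq_mul] at h_mid
  linarith

variable [Nontrivial E]

theorem exists_mem_norm_sub_pos (h : SmoothConvexOn U D φ K L) (hx : x ∈ U) :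
    ∃ y ∈ U, 0 < ‖y - x‖ := by
  obtain ⟨y, hyU, hyx⟩ := (((eventually_nhdsWithin_of_eventually_nhds (h.isOpen.mem_nhds hx)).and
    eventually_mem_nhdsWithin : ∀ᶠ y in 𝓝[≠] x, y ∈ U ∧ y ∈ ({x}ᶜ : Set E))).exists
  exact ⟨y, hyU, norm_pos_iff.2 (sub_ne_zero.2 hyx)⟩

theorem lipschitz_const_nonneg (h : SmoothConvexOn U D φ K L) (hx : x ∈ U) : 0 ≤ K :=
  let ⟨_, hy, hyx⟩ := h.exists_mem_norm_sub_pos hx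
  nonneg_of_norm_sub_le (g := φ) h.abs_sub_le (h.subset hy) (h.subset hx) hyx

theorem gradient_lipschitz_const_nonneg (h : SmoothConvexOn U D φ K L) (hx : x ∈ U) : 0 ≤ L :=
  let ⟨_, hy, hyx⟩ := h.exists_mem_norm_sub_pos hx
  nonneg_of_norm_sub_le h.norm_gradient_sub_le hy hx hyx

theorem norm_gradient_le (h : SmoothConvexOn U D φ K L) (hx : x ∈ U) : ‖gradient φ x‖ ≤ K := by
  have h_fderiv := (h.differentiableAt _ hx).hasGradientAt.hasFDerivAt.le_of_lip'
    (h.lipschitz_const_nonneg hx) (by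
      filter_upwards [h.isOpen.mem_nhds hx] with y hy
      exact h.abs_sub_le y (h.subset hy) x (h.subset hx))
  rwa [LinearIsometryEquiv.norm_map] at h_fderiv

theorem symmetric_mean_le (h : SmoothConvexOn U D φ K L) (hU : ball x μ ⊆ U)
    (hD : closedBall x μ ⊆ D) (hμ : 0 < μ) {w : E} (hw : ‖w‖ ≤ μ) :
    (φ (x + w) + φ (x - w)) / 2 ≤ φ x + min (K * μ) (L / 2 * μ ^ 2) := by
  have hx : x ∈ U := hU (mem_ball_self hμ)
  have hK := h.lipschitz_const_nonneg hx
  have hL := h.gradient_lipschitz_const_nonneg hx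
  have h_lip : ∀ v : E, ‖v‖ ≤ μ → φ (x + v) - φ x ≤ K * μ := fun v hv => by
    have h_abs := h.abs_sub_le (x + v) (hD (by simpa using hv)) x (h.subset hx)
    rw [add_sub_cancel_left] at h_abs
    exact (le_abs_self _).trans (h_abs.trans (by gcongr))
  have h_quad : ∀ v : E, ‖v‖ ≤ μ →
      φ (x + v) - φ x - inner ℝ (gradient φ x) v ≤ L / 2 * μ ^ 2 := fun v hv =>
    (le_abs_self _).trans
      ((h.abs_sub_linear_le_of_mem_closedBall hU hD hμ hv).trans (by gcongr))
  have hw' : ‖-w‖ ≤ μ := by rwa [norm_neg]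
  rw [← min_add_add_left, le_min_iff, sub_eq_add_neg x w]
  refine ⟨by linarith [h_lip w hw, h_lip (-w) hw'], ?_⟩
  have h_neg := h_quad (-w) hw'
  rw [inner_neg_right] at h_neg
  linarith [h_quad w hw]

end SmoothConvexOn

end SmoothConvexOn

section BallSmoothing

variable {E : Type*} [NormedAddCommGroup E] [InnerProductSpace ℝ E] [FiniteDimensional ℝ E]
  [MeasurableSpace E] [BorelSpace E]

/-- The average of `φ` over the ball of radius `μ` around `x`, the smoothed function `f_μ` of the
paper.  Its gradient is what the two-point estimate measures without bias. -/
def ballSmoothing (φ : E → ℝ) (μ : ℝ) (x : E) : ℝ := ⨍ u in ball (0 : E) 1, φ (x + μ • u)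

theorem average_ball_neg (g : E → ℝ) :
    ⨍ u in ball (0 : E) 1, g (-u) = ⨍ u in ball (0 : E) 1, g u := by
  have h_indicator : ∀ u, (ball (0 : E) 1).indicator (fun v => g (-v)) u =
      (ball (0 : E) 1).indicator g (-u) := fun u => by
    by_cases hu : ‖u‖ < 1 <;> simp [indicator, hu]
  simp only [setAverage_eq, ← integral_indicator measurableSet_ball, h_indicator]
  rw [integral_neg_eq_self ((ball (0 : E) 1).indicator g)]

namespace SmoothConvexOn

variable {U D : Set E} {φ : E → ℝ} {K L μ : ℝ} {x y : E}

theorem integrableOn_ball (h : SmoothConvexOn U D φ K L) (hD : closedBall x μ ⊆ D)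
    (hμ : 0 < μ) : IntegrableOn (fun u => φ (x + μ • u)) (ball (0 : E) 1) := by
  have h_cont : ContinuousOn (fun u => φ (x + μ • u)) (closedBall (0 : E) 1) :=
    h.continuousOn.comp (by fun_prop) fun u hu => hD ((add_smul_mem_closedBall_iff hμ).2 hu)
  exact (h_cont.integrableOn_compact (isCompact_closedBall _ _)).mono_set ball_subset_closedBall

theorem integrableOn_ball_sub (h : SmoothConvexOn U D φ K L) (hD : closedBall x μ ⊆ D)
    (hμ : 0 < μ) : IntegrableOn (fun u => φ (x - μ • u)) (ball (0 : E) 1) := by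
  have h_cont : ContinuousOn (fun u => φ (x - μ • u)) (closedBall (0 : E) 1) :=
    h.continuousOn.comp (by fun_prop) fun u hu => hD (by
      simpa only [sub_eq_add_neg, ← smul_neg] using
        (add_smul_mem_closedBall_iff hμ).2 (by simpa using hu))
  exact (h_cont.integrableOn_compact (isCompact_closedBall _ _)).mono_set ball_subset_closedBall

theorem ballSmoothing_eq_average_symmetric_mean (h : SmoothConvexOn U D φ K L)
    (hD : closedBall x μ ⊆ D) (hμ : 0 < μ) :
    ballSmoothing φ μ x = ⨍ u in ball (0 : E) 1, (φ (x + μ • u) + φ (x - μ • u)) / 2 := by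
  have h_neg := average_ball_neg fun u => φ (x + μ • u)
  simp only [smul_neg, ← sub_eq_add_neg, setAverage_eq, smul_eq_mul] at h_neg
  simp only [ballSmoothing, setAverage_eq, smul_eq_mul, integral_div]
  rw [integral_add (h.integrableOn_ball hD hμ) (h.integrableOn_ball_sub hD hμ)]
  linarith

variable [Nontrivial E]

theorem integrableOn_ball_inner_gradient (h : SmoothConvexOn U D φ K L) (hU : ball x μ ⊆ U)
    (hμ : 0 < μ) (v : E) :
    IntegrableOn (fun u => inner ℝ (gradient φ (x + μ • u)) v) (ball (0 : E) 1) := by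
  have h_mem : ∀ u ∈ ball (0 : E) 1, x + μ • u ∈ U := fun u hu =>
    hU ((add_smul_mem_ball_iff hμ).2 hu)
  have h_cont : ContinuousOn (fun u => inner ℝ (gradient φ (x + μ • u)) v) (ball (0 : E) 1) :=
    (h.continuousOn_gradient.comp (by fun_prop) h_mem).inner continuousOn_const
  refine ⟨h_cont.aestronglyMeasurable measurableSet_ball,
    .restrict_of_bounded (C := K * ‖v‖) measure_ball_lt_top ?_⟩
  filter_upwards [ae_restrict_mem measurableSet_ball] with u hu
  refine (norm_inner_le_norm _ _).trans ?_
  gcongr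
  exact h.norm_gradient_le (h_mem u hu)

theorem ballSmoothing_mem_Icc (h : SmoothConvexOn U D φ K L) (hU : ball x μ ⊆ U)
    (hD : closedBall x μ ⊆ D) (hμ : 0 < μ) :
    ballSmoothing φ μ x ∈ Icc (φ x) (φ x + min (K * μ) (L / 2 * μ ^ 2)) := by
  rw [h.ballSmoothing_eq_average_symmetric_mean hD hμ]
  refine (convex_Icc _ _).set_average_mem isClosed_Icc (measure_ball_pos _ _ one_pos).ne'
    measure_ball_lt_top.ne ?_
    (((h.integrableOn_ball hD hμ).add (h.integrableOn_ball_sub hD hμ)).div_const 2)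
  filter_upwards [ae_restrict_mem measurableSet_ball] with u hu
  have hu' : ‖μ • u‖ ≤ μ := by
    simpa using (add_smul_mem_closedBall_iff (x := (0 : E)) hμ).2 (ball_subset_closedBall hu)
  exact ⟨h.le_symmetric_mean (hD (by simpa using hu')) (hD (by simpa using hu')),
    h.symmetric_mean_le hU hD hμ hu'⟩

theorem ballSmoothing_sub_le (h : SmoothConvexOn U D φ K L) (hU : ball x μ ⊆ U)
    (hDx : closedBall x μ ⊆ D) (hDy : closedBall y μ ⊆ D) (hμ : 0 < μ) :
    ballSmoothing φ μ x - ballSmoothing φ μ y ≤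
      ⨍ u in ball (0 : E) 1, inner ℝ (gradient φ (x + μ • u)) (x - y) := by
  have hix := h.integrableOn_ball hDx hμ
  have hiy := h.integrableOn_ball hDy hμ
  simp only [ballSmoothing, setAverage_eq, ← smul_sub, ← integral_sub hix hiy]
  refine smul_le_smul_of_nonneg_left (setIntegral_mono_on (hix.sub hiy)
    (h.integrableOn_ball_inner_gradient hU hμ _) measurableSet_ball fun u hu => ?_)
    (inv_nonneg.2 measureReal_nonneg)
  have h_conv := h.add_inner_gradient_le (hU ((add_smul_mem_ball_iff hμ).2 hu))
    (hDy ((add_smul_mem_closedBall_iff hμ).2 (ball_subset_closedBall hu)))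
  rw [add_sub_add_right_eq_sub, ← neg_sub x y, inner_neg_right] at h_conv
  linarith

end SmoothConvexOn

end BallSmoothing

section TwoPointMoments

variable {n : ℕ} [NeZero n]

namespace SmoothConvexOn

variable {U D : Set (Vec n)} {φ : Vec n → ℝ} {K L μ : ℝ} {x y : Vec n}

theorem average_inner_gradient (h : SmoothConvexOn U D φ K L) (hU : ball x μ ⊆ U)
    (hD : closedBall x μ ⊆ D) (hμ : 0 < μ) (v : Vec n) :
    ⨍ u in ball (0 : Vec n) 1, inner ℝ (gradient φ (x + μ • u)) v =
      n / μ * ∫ e, φ (x + μ • e) * inner ℝ e v ∂uniformSphere n := by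
  have h_div := average_ball_eq_integral_uniformSphere (h.lipschitzOnWith_add_smul hD hμ) v
    (F' := fun u => μ * inner ℝ (gradient φ (x + μ • u)) v) fun u hu => by
      have h_line := h.hasLineDerivAt (hU ((add_smul_mem_ball_iff hμ).2 hu)) (μ • v)
      simpa only [HasLineDerivAt, inner_smul_right, smul_add, add_assoc, smul_comm _ μ] using h_line
  rw [setAverage_eq, integral_const_mul, ← mul_smul_comm, ← setAverage_eq] at h_div
  rw [div_mul_eq_mul_div, ← h_div, mul_div_cancel_left₀ _ hμ.ne']

theorem sub_sub_min_le_integral_uniformSphere (h : SmoothConvexOn U D φ K L)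
    (hUx : ball x μ ⊆ U) (hDx : closedBall x μ ⊆ D) (hUy : ball y μ ⊆ U)
    (hDy : closedBall y μ ⊆ D) (hμ : 0 < μ) :
    φ x - φ y - min (K * μ) (L / 2 * μ ^ 2) ≤
      n / μ * ∫ e, φ (x + μ • e) * inner ℝ e (x - y) ∂uniformSphere n := by
  rw [← h.average_inner_gradient hUx hDx hμ]
  linarith [(h.ballSmoothing_mem_Icc hUx hDx hμ).1, (h.ballSmoothing_mem_Icc hUy hDy hμ).2,
    h.ballSmoothing_sub_le hUx hDx hDy hμ]

theorem integral_uniformSphere_sq_supNorm_mul_le (h : SmoothConvexOn U D φ K L)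
    (hU : ball x μ ⊆ U) (hD : closedBall x μ ⊆ D) (hμ : 0 < μ) {δ : ℝ} (hδ : 0 ≤ δ) :
    ∫ e, (n / μ * supNorm e * (|φ (x + μ • e) - φ x| + 2 * δ)) ^ 2 ∂uniformSphere n ≤
      n * supMoment n * (7 / 5 * K ^ 2 + 7 * n * (L ^ 2 * μ ^ 2 / 4 + 4 * δ ^ 2 / μ ^ 2)) := by
  have hn : (0 : ℝ) < n := Nat.cast_pos.2 (NeZero.pos n)
  set s := gradient φ x
  set r := 7 * (L ^ 2 * μ ^ 2 / 4 + 4 * δ ^ 2 / μ ^ 2)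
  have h_lin : Integrable (fun e : Vec n => 7 / 5 * (inner ℝ s e ^ 2 * supNorm e ^ 2))
      (uniformSphere n) := integrable_uniformSphere_of_continuous
    (((by fun_prop : Continuous fun e : Vec n => inner ℝ s e ^ 2).mul
      (continuous_supNorm.pow 2)).const_mul _)
  have h_rem : Integrable (fun e : Vec n => r * supNorm e ^ 2) (uniformSphere n) :=
    integrable_uniformSphere_of_continuous ((continuous_supNorm.pow 2).const_mul r)
  have h_le : ∀ᵐ e ∂uniformSphere n,
      (n / μ * supNorm e * (|φ (x + μ • e) - φ x| + 2 * δ)) ^ 2 ≤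
        n ^ 2 * (7 / 5 * (inner ℝ s e ^ 2 * supNorm e ^ 2) + r * supNorm e ^ 2) := by
    filter_upwards [ae_uniformSphere_norm_eq_one] with e he
    rw [mul_pow]
    refine (mul_le_mul_of_nonneg_left (h.sq_abs_sub_add_le hU hD hμ hδ he)
      (sq_nonneg _)).trans_eq ?_
    simp only [s, r]
    field_simp
  calc ∫ e, (n / μ * supNorm e * (|φ (x + μ • e) - φ x| + 2 * δ)) ^ 2 ∂uniformSphere n
      ≤ ∫ e, n ^ 2 * (7 / 5 * (inner ℝ s e ^ 2 * supNorm e ^ 2) + r * supNorm e ^ 2)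
          ∂uniformSphere n :=
        integral_mono_of_nonneg (ae_of_all _ fun _ => sq_nonneg _)
          ((h_lin.add h_rem).const_mul _) h_le
    _ = n * supMoment n * (7 / 5 * ‖s‖ ^ 2 + n * r) := by
        rw [integral_const_mul, integral_add h_lin h_rem, integral_const_mul, integral_const_mul,
          integral_inner_sq_mul_supNorm_sq, ← supMoment]
        field_simp
    _ ≤ n * supMoment n * (7 / 5 * K ^ 2 + n * r) := by
        have h_moment := supMoment_nonneg (n := n)
        gcongr
        exact h.norm_gradient_le (hU (mem_ball_self hμ))
    _ = n * supMoment n * (7 / 5 * K ^ 2 +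
          7 * n * (L ^ 2 * μ ^ 2 / 4 + 4 * δ ^ 2 / μ ^ 2)) := by
        simp only [r]
        ring

end SmoothConvexOn

end TwoPointMoments

/-! ### Stochastic convex functions near the simplex -/

section Neighbourhood

variable {n : ℕ} {μ μ₀ : ℝ} {x : Vec n}

theorem isCompact_simplex : IsCompact (simplex n) := by
  have h_image : simplex n = WithLp.toLp 2 '' stdSimplex ℝ (Fin n) := by
    ext x
    exact ⟨fun hx => ⟨WithLp.ofLp x, hx, rfl⟩, by rintro ⟨y, hy, rfl⟩; exact hy⟩
  rw [h_image]
  exact (isCompact_stdSimplex ℝ (Fin n)).image (PiLp.continuous_toLp 2 _)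

theorem convex_simplex : Convex ℝ (simplex n) :=
  (convex_stdSimplex ℝ (Fin n)).linear_preimage
    (WithLp.linearEquiv 2 ℝ (Fin n → ℝ)).toLinearMap

theorem simplex_nonempty [NeZero n] : (simplex n).Nonempty :=
  ⟨_, mirror_mem_simplex 1 0⟩

theorem simplex_subset_closedNhd : simplex n ⊆ closedNhd n μ₀ :=
  self_subset_cthickening _

theorem ball_subset_openNhd (hx : x ∈ simplex n) (hμ : μ ≤ μ₀) : ball x μ ⊆ openNhd n μ₀ :=
  (ball_subset_thickening hx μ).trans (thickening_mono hμ _)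

theorem closedBall_subset_closedNhd (hx : x ∈ simplex n) (hμ : μ ≤ μ₀) :
    closedBall x μ ⊆ closedNhd n μ₀ :=
  (closedBall_subset_cthickening hx μ).trans (cthickening_mono hμ _)

theorem add_smul_mem_closedNhd (hx : x ∈ simplex n) (hμ₀ : 0 ≤ μ) (hμ : μ ≤ μ₀) {e : Vec n}
    (he : ‖e‖ = 1) : x + μ • e ∈ closedNhd n μ₀ :=
  closedBall_subset_closedNhd hx hμ (by simp [norm_smul, he, abs_of_nonneg hμ₀])

end Neighbourhood

section RootMeanSquare

variable {H : Type*} [MeasurableSpace H] {ν : Measure H} {K : H → ℝ}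

theorem sq_rms : rms ν K ^ 2 = ∫ h, K h ^ 2 ∂ν :=
  Real.sq_sqrt (integral_nonneg fun _ => sq_nonneg _)

variable [IsProbabilityMeasure ν]

theorem integral_le_rms (hK : MemLp K 2 ν) : ∫ h, K h ∂ν ≤ rms ν K := by
  have h_var := variance_nonneg K ν
  rw [variance_eq_sub hK] at h_var
  exact Real.le_sqrt_of_sq_le (sub_nonneg.1 h_var)

theorem norm_integral_sub_integral_le_rms_mul {G : Type*} [NormedAddCommGroup G]
    [NormedSpace ℝ G] {g₁ g₂ : H → G} (hg₁ : Integrable g₁ ν) (hg₂ : Integrable g₂ ν)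
    (hK : MemLp K 2 ν) {c : ℝ} (hc : 0 ≤ c) (h : ∀ᵐ h ∂ν, ‖g₁ h - g₂ h‖ ≤ K h * c) :
    ‖∫ h, g₁ h ∂ν - ∫ h, g₂ h ∂ν‖ ≤ rms ν K * c :=
  calc ‖∫ h, g₁ h ∂ν - ∫ h, g₂ h ∂ν‖
      = ‖∫ h, (g₁ h - g₂ h) ∂ν‖ := by rw [integral_sub hg₁ hg₂]
    _ ≤ ∫ h, K h * c ∂ν :=
        norm_integral_le_of_norm_le ((hK.integrable one_le_two).mul_const c) h
    _ = (∫ h, K h ∂ν) * c := integral_mul_const _ _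
    _ ≤ rms ν K * c := by
        gcongr
        exact integral_le_rms hK

end RootMeanSquare

section MeasurableVersion

variable {X : Type*} [PseudoMetricSpace X] {S : Set X}

-- McShane's extension formula, with the infimum taken over a countable dense set only.
theorem ciInf_add_mul_dist_eq {g : X → ℝ} {C : ℝ}
    (hg : ∀ x ∈ S, ∀ y ∈ S, |g x - g y| ≤ C * dist x y) {d : ℕ → S} (hd : DenseRange d) {x : X}
    (hx : x ∈ S) : ⨅ k, (g (d k) + C * dist x (d k)) = g x := by
  have h_lower : ∀ k, g x ≤ g (d k) + C * dist x (d k) := fun k => by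
    linarith [le_abs_self (g x - g (d k)), hg x hx (d k) (d k).2]
  have h_lip : LipschitzOnWith C.toNNReal g S := LipschitzOnWith.of_dist_le' hg
  have h_cont : Continuous fun y : S => g y + C * dist x y :=
    h_lip.continuousOn.domRestrict.add (by fun_prop)
  have h_upper : ∀ y : S, ⨅ k, (g (d k) + C * dist x (d k)) ≤ g y + C * dist x y := fun y =>
    hd.induction_on y (isClosed_le continuous_const h_cont)
      (ciInf_le ⟨g x, forall_mem_range.2 h_lower⟩)
  exact le_antisymm (by simpa using h_upper ⟨x, hx⟩) (le_ciInf h_lower)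

theorem exists_measurable_uncurry_eq [SecondCountableTopology X] [MeasurableSpace X]
    [OpensMeasurableSpace X] {H : Type*} [MeasurableSpace H] {ν : Measure H} (hS : S.Nonempty)
    {f : X → H → ℝ} {K : H → ℝ} (hf : ∀ x ∈ S, AEMeasurable (f x) ν) (hK : AEMeasurable K ν)
    (h_lip : ∀ᵐ h ∂ν, ∀ x ∈ S, ∀ y ∈ S, |f x h - f y h| ≤ K h * dist x y) :
    ∃ g : X → H → ℝ, Measurable (Function.uncurry g) ∧ ∀ᵐ h ∂ν, ∀ x ∈ S, g x h = f x h := by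
  have := hS.to_subtype
  let d : ℕ → S := TopologicalSpace.denseSeq S
  let m : ℕ → H → ℝ := fun k => (hf (d k) (d k).2).mk (f (d k))
  refine ⟨fun x h => ⨅ k, (m k h + hK.mk K h * dist x (d k)), Measurable.iInf fun k => ?_, ?_⟩
  · exact ((hf (d k) (d k).2).measurable_mk.comp measurable_snd).add
      ((hK.measurable_mk.comp measurable_snd).mul (measurable_fst.dist measurable_const))
  · filter_upwards [h_lip, hK.ae_eq_mk, ae_all_iff.2 fun k => (hf (d k) (d k).2).ae_eq_mk]
      with h h_lip hKh hm x hx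
    simp only [m, ← hKh, ← hm]
    exact ciInf_add_mul_dist_eq h_lip (TopologicalSpace.denseRange_denseSeq S) hx

end MeasurableVersion

namespace SmoothSetting

variable {n : ℕ} {H : Type*} [MeasurableSpace H] {ν : Measure H} {μ₀ : ℝ} {f : Vec n → H → ℝ}
  {K L : H → ℝ}

theorem ae_smoothConvexOn (hf : SmoothSetting ν μ₀ f K L) :
    ∀ᵐ h ∂ν, SmoothConvexOn (openNhd n μ₀) (closedNhd n μ₀) (fun x => f x h) (K h) (L h) := by
  filter_upwards [hf.convex, hf.lipschitz, hf.differentiable, hf.gradient_lipschitz]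
    with h h_convex h_lip h_diff h_grad
  exact ⟨isOpen_thickening, thickening_subset_cthickening _ _, h_convex, h_lip, h_diff, h_grad⟩

theorem convexOn_objective (hf : SmoothSetting ν μ₀ f K L) :
    ConvexOn ℝ (closedNhd n μ₀) (objective ν f) := by
  have h_nhd : Convex ℝ (closedNhd n μ₀) := convex_simplex.cthickening μ₀
  refine ⟨h_nhd, fun x hx y hy a b ha hb hab => ?_⟩
  have hix := (hf.integrable x hx).const_mul a
  have hiy := (hf.integrable y hy).const_mul b
  simp only [objective, smul_eq_mul, ← integral_const_mul, ← integral_add hix hiy]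
  refine integral_mono_ae (hf.integrable _ (h_nhd hx hy ha hb hab)) (hix.add hiy) ?_
  filter_upwards [hf.convex] with h h_conv using h_conv.2 hx hy ha hb hab

theorem smoothConvexOn_objective [IsProbabilityMeasure ν] (hf : SmoothSetting ν μ₀ f K L) :
    SmoothConvexOn (openNhd n μ₀) (closedNhd n μ₀) (objective ν f) (rms ν K) (rms ν L) where
  isOpen := isOpen_thickening
  subset := thickening_subset_cthickening _ _
  convexOn := hf.convexOn_objective
  abs_sub_le x hx y hy :=
    norm_integral_sub_integral_le_rms_mul (hf.integrable x hx) (hf.integrable y hy)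
      hf.lipschitz_memLp (norm_nonneg _) (hf.lipschitz.mono fun _ h => h x hx y hy)
  differentiableAt x hx := (hf.gradient_expectation x hx).2.differentiableAt
  norm_gradient_sub_le x hx y hy := by
    obtain ⟨hix, h_grad_x⟩ := hf.gradient_expectation x hx
    obtain ⟨hiy, h_grad_y⟩ := hf.gradient_expectation y hy
    rw [h_grad_x.gradient, h_grad_y.gradient]
    exact norm_integral_sub_integral_le_rms_mul hix hiy hf.gradient_lipschitz_memLp (norm_nonneg _)
      (hf.gradient_lipschitz.mono fun _ h => h x hx y hy)

theorem exists_measurable_uncurry_eq [NeZero n] (hf : SmoothSetting ν μ₀ f K L) :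
    ∃ g : Vec n → H → ℝ, Measurable (Function.uncurry g) ∧
      ∀ᵐ h ∂ν, ∀ x ∈ closedNhd n μ₀, g x h = f x h := by
  refine GradientFree.exists_measurable_uncurry_eq
    (simplex_nonempty.mono simplex_subset_closedNhd)
    (fun x hx => (hf.integrable x hx).aemeasurable) hf.lipschitz_memLp.1.aemeasurable ?_
  simpa only [dist_eq_norm] using hf.lipschitz

end SmoothSetting

section SmoothingRadius

variable {n : ℕ} {ε δ μ M₂ L₂ : ℝ}

theorem smoothingRadius_pos (hn : 0 < n) (hε : 0 < ε) (hM : 0 < M₂) (hL : 0 < L₂) :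
    0 < smoothingRadius n ε M₂ L₂ := by
  exact lt_min (lt_max_of_lt_left (by positivity)) (by positivity)

theorem min_le_half_of_le_max (hε : 0 ≤ ε) (hM : 0 < M₂) (hL : 0 < L₂) (hμ : 0 ≤ μ)
    (h : μ ≤ max (ε / (2 * M₂)) (Real.sqrt (ε / L₂))) :
    min (M₂ * μ) (L₂ / 2 * μ ^ 2) ≤ ε / 2 := by
  rcases le_max_iff.1 h with h | h
  · rw [le_div_iff₀ (by positivity)] at h
    exact min_le_of_left_le (by linarith)
  · rw [Real.le_sqrt hμ (by positivity), le_div_iff₀ hL] at h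
    exact min_le_of_right_le (by linarith)

theorem sq_mul_sq_le_of_le_mul_sqrt (hL : 0 < L₂) (hμ : 0 ≤ μ)
    (h : μ ≤ M₂ / L₂ * Real.sqrt (1 / (6 * n))) : L₂ ^ 2 * μ ^ 2 ≤ M₂ ^ 2 / (6 * n) :=
  calc L₂ ^ 2 * μ ^ 2 ≤ L₂ ^ 2 * (M₂ / L₂ * Real.sqrt (1 / (6 * n))) ^ 2 := by gcongr
    _ = M₂ ^ 2 / (6 * n) := by
        rw [mul_pow, Real.sq_sqrt (by positivity)]
        field_simp

theorem sq_div_sq_le_of_le_mul_div_sqrt (hδ : 0 ≤ δ) (hμ : 0 < μ)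
    (h : δ ≤ M₂ * μ / Real.sqrt (96 * n)) : δ ^ 2 / μ ^ 2 ≤ M₂ ^ 2 / (96 * n) :=
  calc δ ^ 2 / μ ^ 2 ≤ (M₂ * μ / Real.sqrt (96 * n)) ^ 2 / μ ^ 2 := by gcongr
    _ = M₂ ^ 2 / (96 * n) := by
        rw [div_pow, Real.sq_sqrt (by positivity)]
        field_simp

theorem mul_supMoment_mul_le (hn : 2 ≤ n) (hL : 0 < L₂) (hδ : 0 ≤ δ) (hμ : 0 < μ)
    (hμ_le : μ ≤ M₂ / L₂ * Real.sqrt (1 / (6 * n))) (hδ_le : δ ≤ M₂ * μ / Real.sqrt (96 * n)) :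
    n * supMoment n * (7 / 5 * M₂ ^ 2 + 7 * n * (L₂ ^ 2 * μ ^ 2 / 4 + 4 * δ ^ 2 / μ ^ 2)) ≤
      5 * M₂ ^ 2 * Real.log n := by
  have : (0 : ℝ) < n := Nat.cast_pos.2 (by lia)
  have h_smooth := sq_mul_sq_le_of_le_mul_sqrt hL hμ.le hμ_le
  have h_noise := sq_div_sq_le_of_le_mul_div_sqrt hδ hμ hδ_le
  have h_var :
      7 / 5 * M₂ ^ 2 + 7 * n * (L₂ ^ 2 * μ ^ 2 / 4 + 4 * δ ^ 2 / μ ^ 2) ≤ 2 * M₂ ^ 2 :=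
    calc 7 / 5 * M₂ ^ 2 + 7 * n * (L₂ ^ 2 * μ ^ 2 / 4 + 4 * δ ^ 2 / μ ^ 2)
        ≤ 7 / 5 * M₂ ^ 2 + 7 * n * (M₂ ^ 2 / (6 * n) / 4 + 4 * (M₂ ^ 2 / (96 * n))) := by
          rw [mul_div_assoc 4]
          gcongr
      _ = 119 / 60 * M₂ ^ 2 := by
          field_simp
          ring
      _ ≤ 2 * M₂ ^ 2 := by gcongr; norm_num
  have : NeZero n := ⟨by lia⟩
  have h_moment := supMoment_nonneg (n := n)
  calc n * supMoment n * (7 / 5 * M₂ ^ 2 + 7 * n * (L₂ ^ 2 * μ ^ 2 / 4 + 4 * δ ^ 2 / μ ^ 2))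
      ≤ n * supMoment n * (2 * M₂ ^ 2) := by gcongr
    _ ≤ 5 / 2 * Real.log n * (2 * M₂ ^ 2) :=
        mul_le_mul_of_nonneg_right (mul_supMoment_le hn) (by positivity)
    _ = 5 * M₂ ^ 2 * Real.log n := by ring

end SmoothingRadius

section StepParam

variable {n : ℕ} {ε M₂ : ℝ}

theorem stepParam_pos (hM : 0 < M₂) {t : ℕ} (ht : 0 < t) : 0 < stepParam M₂ t :=
  mul_pos hM (Real.sqrt_pos.2 (by positivity))

theorem stepParam_mono (hM : 0 ≤ M₂) : Monotone (stepParam M₂) := fun s t hst => by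
  unfold stepParam
  gcongr

theorem sq_stepParam (M₂ : ℝ) (t : ℕ) : stepParam M₂ t ^ 2 = 5 * M₂ ^ 2 * t := by
  rw [stepParam, mul_pow, Real.sq_sqrt (by positivity)]
  ring

theorem sum_div_stepParam_le (hM : 0 < M₂) (N : ℕ) :
    ∑ t ∈ Finset.range N, 5 * M₂ ^ 2 / (2 * stepParam M₂ (t + 1)) ≤ stepParam M₂ N := by
  induction N with
  | zero => simp [stepParam]
  | succ N ih =>
    have h_pos : 0 < stepParam M₂ (N + 1) := stepParam_pos hM N.succ_pos
    have h_step : 5 * M₂ ^ 2 / (2 * stepParam M₂ (N + 1)) ≤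
        stepParam M₂ (N + 1) - stepParam M₂ N := by
      have h_sq := sq_stepParam M₂ (N + 1)
      push_cast at h_sq
      rw [div_le_iff₀ (by positivity)]
      nlinarith [sq_nonneg (stepParam M₂ (N + 1) - stepParam M₂ N), sq_stepParam M₂ N]
    rw [Finset.sum_range_succ]
    linarith

theorem iterationCount_pos (hn : 2 ≤ n) (hε : 0 < ε) (hM : 0 < M₂) :
    0 < iterationCount n ε M₂ := by
  have h_log : 0 < Real.log n := Real.log_pos (Nat.one_lt_cast.2 hn)
  exact Nat.ceil_pos.2 (by positivity)

theorem two_mul_stepParam_mul_log_le (hε : 0 < ε) {N : ℕ} (hN : iterationCount n ε M₂ ≤ N) :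
    2 * (stepParam M₂ N * Real.log n) ≤ N * (ε / 2) := by
  have h_ceil := Nat.ceil_le.1 hN
  rw [div_le_iff₀ (by positivity)] at h_ceil
  refine le_of_sq_le_sq ?_ (by positivity)
  calc (2 * (stepParam M₂ N * Real.log n)) ^ 2
      = N / 4 * (80 * M₂ ^ 2 * Real.log n ^ 2) := by
        rw [mul_pow, mul_pow, sq_stepParam]
        ring
    _ ≤ N / 4 * (N * ε ^ 2) := by gcongr
    _ = (N * (ε / 2)) ^ 2 := by ring

end StepParam

section Independence

variable {Ω α β γ : Type*} [MeasurableSpace Ω] [MeasurableSpace α] [MeasurableSpace β]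
  [MeasurableSpace γ] {P : Measure Ω} [IsProbabilityMeasure P] {A : Ω → α} {B : Ω → β} {C : Ω → γ}

theorem indepFun_prodMk_left_of_prodMk_right (hA : Measurable A) (hB : Measurable B)
    (hC : Measurable C) (hABC : IndepFun A (fun ω => (B ω, C ω)) P) (hBC : IndepFun B C P) :
    IndepFun (fun ω => (A ω, B ω)) C P := by
  have hAB : IndepFun A B P := hABC.comp measurable_id measurable_fst
  rw [indepFun_iff_map_prod_eq_prod_map_map (hA.prodMk hB).aemeasurable hC.aemeasurable,
    hAB.map_prod_eq_prod_map_map hA.aemeasurable hB.aemeasurable]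
  refine MeasurableEquiv.prodAssoc.map_measurableEquiv_injective ?_
  rw [Measure.prodAssoc_prod, ← hBC.map_prod_eq_prod_map_map hB.aemeasurable hC.aemeasurable,
    ← hABC.map_prod_eq_prod_map_map hA.aemeasurable (hB.prodMk hC).aemeasurable,
    Measure.map_map MeasurableEquiv.prodAssoc.measurable ((hA.prodMk hB).prodMk hC)]
  rfl

variable {ρ : Measure α} {E : Type*} [NormedAddCommGroup E] {G : α × β → E}

theorem measurePreserving_prodMk_of_indepFun (hA : MeasurePreserving A P ρ) (hB : Measurable B)
    (h : IndepFun A B P) :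
    MeasurePreserving (fun ω => (A ω, B ω)) P (ρ.prod (P.map B)) :=
  ⟨hA.measurable.prodMk hB, by
    rw [h.map_prod_eq_prod_map_map hA.aemeasurable hB.aemeasurable, hA.map_eq]⟩

theorem integrable_prod_of_indepFun (hA : MeasurePreserving A P ρ) (hB : Measurable B)
    (h : IndepFun A B P) (hG : StronglyMeasurable G)
    (hi : Integrable (fun ω => G (A ω, B ω)) P) : Integrable G (ρ.prod (P.map B)) :=
  ((measurePreserving_prodMk_of_indepFun hA hB h).integrable_comp hG.aestronglyMeasurable).1 hi

variable [SFinite ρ] [NormedSpace ℝ E]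

theorem integrable_integral_of_indepFun (hA : MeasurePreserving A P ρ) (hB : Measurable B)
    (h : IndepFun A B P) (hG : StronglyMeasurable G)
    (hi : Integrable (fun ω => G (A ω, B ω)) P) :
    Integrable (fun ω => ∫ a, G (a, B ω) ∂ρ) P :=
  (integrable_prod_of_indepFun hA hB h hG hi).integral_prod_right.comp_measurable hB

theorem integral_eq_integral_integral_of_indepFun (hA : MeasurePreserving A P ρ)
    (hB : Measurable B) (h : IndepFun A B P) (hG : StronglyMeasurable G)
    (hi : Integrable (fun ω => G (A ω, B ω)) P) :
    ∫ ω, G (A ω, B ω) ∂P = ∫ ω, ∫ a, G (a, B ω) ∂ρ ∂P := by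
  have hi_prod := integrable_prod_of_indepFun hA hB h hG hi
  have h_pres := measurePreserving_prodMk_of_indepFun hA hB h
  rw [← integral_map (f := G) h_pres.aemeasurable hG.aestronglyMeasurable, h_pres.map_eq,
    integral_prod_symm _ hi_prod,
    integral_map hB.aemeasurable hi_prod.integral_prod_right.aestronglyMeasurable]

end Independence

section SimplexBounds

variable {n : ℕ}

theorem norm_le_one_of_mem_simplex {x : Vec n} (hx : x ∈ simplex n) : ‖x‖ ≤ 1 := by
  have h_apply_le_one (i) : x i ≤ 1 :=
    hx.2 ▸ Finset.single_le_sum (fun j _ => hx.1 j) (Finset.mem_univ i)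
  rw [← sq_le_one_iff₀ (norm_nonneg x), EuclideanSpace.real_norm_sq_eq, ← hx.2]
  exact Finset.sum_le_sum fun i _ => by nlinarith [h_apply_le_one i, hx.1 i]

theorem isBounded_closedNhd {μ₀ : ℝ} : Bornology.IsBounded (closedNhd n μ₀) :=
  isCompact_simplex.isBounded.cthickening

end SimplexBounds

section UniformDirection

variable {n : ℕ} {Ω : Type*} [MeasurableSpace Ω] {P : Measure Ω} {e V : Ω → Vec n}

theorem ae_norm_eq_one (he : MeasurePreserving e P (uniformSphere n)) : ∀ᵐ ω ∂P, ‖e ω‖ = 1 :=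
  he.quasiMeasurePreserving.ae ae_uniformSphere_norm_eq_one

theorem integral_inner_eq_zero_of_indepFun [NeZero n] [IsProbabilityMeasure P]
    (he : MeasurePreserving e P (uniformSphere n)) (hV : Measurable V) (h : IndepFun e V P)
    (hi : Integrable (fun ω => inner ℝ (e ω) (V ω)) P) : ∫ ω, inner ℝ (e ω) (V ω) ∂P = 0 := by
  rw [integral_eq_integral_integral_of_indepFun (G := fun p => inner ℝ p.1 p.2) he hV h
    (by fun_prop) hi]
  simp only [integral_uniformSphere_inner, integral_zero]

end UniformDirection

theorem supNorm_gradEstimate_le {n : ℕ} {H : Type*} {φ : Vec n → H → ℝ} {μ δ ξ ξ₀ : ℝ}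
    (hμ : 0 < μ) (hξ : |ξ| ≤ δ) (hξ₀ : |ξ₀| ≤ δ) (x e : Vec n) (h : H) :
    supNorm (gradEstimate φ μ x e h ξ ξ₀) ≤
      n / μ * supNorm e * (|φ (x + μ • e) h - φ x h| + 2 * δ) := by
  have h_increment_le : |φ (x + μ • e) h + ξ - (φ x h + ξ₀)| ≤
      |φ (x + μ • e) h - φ x h| + 2 * δ := by
    rw [add_sub_add_comm]
    linarith [abs_add_le (φ (x + μ • e) h - φ x h) (ξ - ξ₀), abs_sub ξ ξ₀]
  rw [gradEstimate, supNorm_smul, abs_mul, abs_of_nonneg (by positivity : 0 ≤ (n : ℝ) / μ),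
    mul_right_comm]
  have := supNorm_nonneg e
  gcongr

section RandomEvaluation

variable {n : ℕ} {H Ω : Type*} [MeasurableSpace H] [MeasurableSpace Ω]
  {ν : Measure H} {P : Measure Ω} {φ : Vec n → H → ℝ} {K L : H → ℝ} {μ₀ : ℝ} {X : Ω → Vec n}

theorem measurable_objective [SFinite ν] (hφ : Measurable (Function.uncurry φ)) :
    Measurable (objective ν φ) :=
  hφ.stronglyMeasurable.integral_prod_right.measurable

theorem measurable_gradEstimate (hφ : Measurable (Function.uncurry φ)) (μ : ℝ)
    {e : Ω → Vec n} {η : Ω → H} {ξ ξ₀ : Ω → ℝ} (hX : Measurable X) (he : Measurable e)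
    (hη : Measurable η) (hξ : Measurable ξ) (hξ₀ : Measurable ξ₀) :
    Measurable fun ω => gradEstimate φ μ (X ω) (e ω) (η ω) (ξ ω) (ξ₀ ω) := by
  have h_shift := hφ.comp ((hX.add (he.const_smul μ)).prodMk hη)
  exact (((h_shift.add hξ).sub ((hφ.comp (hX.prodMk hη)).add hξ₀)).const_mul _).smul he

variable [NeZero n]

theorem SmoothSetting.integrable_comp [IsFiniteMeasure ν] (hf : SmoothSetting ν μ₀ φ K L)
    (hφ : Measurable (Function.uncurry φ)) {η : Ω → H} (hη : MeasurePreserving η P ν)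
    (hX : Measurable X) (hX_mem : ∀ᵐ ω ∂P, X ω ∈ closedNhd n μ₀) :
    Integrable (fun ω => φ (X ω) (η ω)) P := by
  obtain ⟨x₀, hx₀⟩ := simplex_nonempty (n := n)
  have hx₀_mem : x₀ ∈ closedNhd n μ₀ := simplex_subset_closedNhd hx₀
  obtain ⟨R, hR⟩ := isBounded_closedNhd.subset_closedBall (s := closedNhd n μ₀) x₀
  have h_dom : Integrable (fun ω => |φ x₀ (η ω)| + |K (η ω)| * R) P :=
    hη.integrable_comp_of_integrable ((hf.integrable x₀ hx₀_mem).abs.add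
      ((hf.lipschitz_memLp.integrable one_le_two).abs.mul_const R))
  refine h_dom.mono' (hφ.comp (hX.prodMk hη.measurable)).aestronglyMeasurable ?_
  filter_upwards [hX_mem, hη.quasiMeasurePreserving.ae hf.lipschitz] with ω hω h_lip
  have h_le : K (η ω) * ‖X ω - x₀‖ ≤ |K (η ω)| * R := by
    gcongr
    · exact le_abs_self _
    · exact mem_closedBall_iff_norm.1 (hR hω)
  linarith [norm_sub_norm_le (φ (X ω) (η ω)) (φ x₀ (η ω)), h_lip _ hω _ hx₀_mem,
    Real.norm_eq_abs (φ x₀ (η ω)), Real.norm_eq_abs (φ (X ω) (η ω) - φ x₀ (η ω))]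

theorem SmoothSetting.integrable_objective_comp [IsProbabilityMeasure ν] [IsProbabilityMeasure P]
    (hf : SmoothSetting ν μ₀ φ K L) (hφ : Measurable (Function.uncurry φ))
    (hX : Measurable X) (hX_mem : ∀ᵐ ω ∂P, X ω ∈ closedNhd n μ₀) :
    Integrable (fun ω => objective ν φ (X ω)) P :=
  (hf.integrable_comp hφ (measurePreserving_snd (μ := P)) (hX.comp measurable_fst)
    (Measure.quasiMeasurePreserving_fst.ae hX_mem)).integral_prod_left

end RandomEvaluation

/-! ### A single query of the oracle -/

section OracleStep

variable {n : ℕ} {H Ω : Type*} [MeasurableSpace H] [MeasurableSpace Ω]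

/-- One query of the noisy two-point oracle at a random point `X` of the simplex.  It isolates what
an `OracleModel` provides at a single step, with the past reduced to the current point. -/
structure OracleStep (P : Measure Ω) (ν : Measure H) (δ : ℝ) (X e : Ω → Vec n) (η : Ω → H)
    (ξ ξ₀ : Ω → ℝ) : Prop where
  measurable_point : Measurable X
  point_mem : ∀ ω, X ω ∈ simplex n
  direction : MeasurePreserving e P (uniformSphere n)
  realisation : MeasurePreserving η P ν
  measurable_noise : Measurable ξ
  measurable_noise₀ : Measurable ξ₀
  noise_le : ∀ᵐ ω ∂P, |ξ ω| ≤ δ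
  noise₀_le : ∀ᵐ ω ∂P, |ξ₀ ω| ≤ δ
  indep_realisation : IndepFun η X P
  indep_direction : IndepFun e (fun ω => (X ω, η ω)) P
  indep_noise : IndepFun e (fun ω => (X ω, ξ ω)) P
  indep_noise₀ : IndepFun e (fun ω => (X ω, ξ₀ ω)) P

namespace OracleStep

variable {P : Measure Ω} {ν : Measure H} {δ μ μ₀ : ℝ} {X e : Ω → Vec n} {η : Ω → H}
  {ξ ξ₀ : Ω → ℝ} {φ : Vec n → H → ℝ} {K L : H → ℝ}

theorem integrable_mul_inner (h : OracleStep P ν δ X e η ξ ξ₀) {ζ : Ω → ℝ} (hζ : Integrable ζ P)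
    (u : Vec n) : Integrable (fun ω => ζ ω * inner ℝ (e ω) (X ω - u)) P := by
  refine hζ.mul_bdd (c := 1 + ‖u‖) (h.direction.measurable.inner
    (h.measurable_point.sub_const u)).aestronglyMeasurable ?_
  filter_upwards [ae_norm_eq_one h.direction] with ω hω
  calc ‖inner ℝ (e ω) (X ω - u)‖ ≤ ‖e ω‖ * ‖X ω - u‖ := norm_inner_le_norm _ _
    _ ≤ 1 + ‖u‖ := by
        rw [hω, one_mul]
        linarith [norm_sub_le (X ω) u, norm_le_one_of_mem_simplex (h.point_mem ω)]

theorem shift_mem (h : OracleStep P ν δ X e η ξ ξ₀) (hμ : 0 ≤ μ) (hμ₀ : μ ≤ μ₀) :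
    ∀ᵐ ω ∂P, X ω + μ • e ω ∈ closedNhd n μ₀ :=
  (ae_norm_eq_one h.direction).mono fun ω hω => add_smul_mem_closedNhd (h.point_mem ω) hμ hμ₀ hω

theorem indep_direction_point (h : OracleStep P ν δ X e η ξ ξ₀) : IndepFun e X P :=
  h.indep_direction.comp measurable_id measurable_fst

theorem integrable_value [NeZero n] [IsFiniteMeasure ν] (h : OracleStep P ν δ X e η ξ ξ₀)
    (hf : SmoothSetting ν μ₀ φ K L) (hφ : Measurable (Function.uncurry φ)) :
    Integrable (fun ω => φ (X ω) (η ω)) P :=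
  hf.integrable_comp hφ h.realisation h.measurable_point
    (ae_of_all P fun ω => simplex_subset_closedNhd (h.point_mem ω))

theorem integrable_shift_value [NeZero n] [IsFiniteMeasure ν] (h : OracleStep P ν δ X e η ξ ξ₀)
    (hf : SmoothSetting ν μ₀ φ K L) (hφ : Measurable (Function.uncurry φ))
    (hμ : 0 ≤ μ) (hμ₀ : μ ≤ μ₀) :
    Integrable (fun ω => φ (X ω + μ • e ω) (η ω)) P :=
  hf.integrable_comp hφ h.realisation
    (h.measurable_point.add (h.direction.measurable.const_smul μ)) (h.shift_mem hμ hμ₀)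

theorem integrable_sq_comp_realisation (h : OracleStep P ν δ X e η ξ ξ₀) (hK : MemLp K 2 ν) :
    Integrable (fun ω => K (η ω) ^ 2) P :=
  (hK.comp_measurePreserving h.realisation).integrable_sq

theorem integral_sq_comp_realisation (h : OracleStep P ν δ X e η ξ ξ₀) (hK : MemLp K 2 ν) :
    ∫ ω, K (η ω) ^ 2 ∂P = rms ν K ^ 2 := by
  rw [sq_rms, ← h.realisation.map_eq, integral_map h.realisation.aemeasurable]
  rw [h.realisation.map_eq]
  exact hK.1.pow 2

theorem sq_supNorm_gradEstimate_ae_le (h : OracleStep P ν δ X e η ξ ξ₀) (hμ : 0 < μ) :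
    ∀ᵐ ω ∂P, supNorm (gradEstimate φ μ (X ω) (e ω) (η ω) (ξ ω) (ξ₀ ω)) ^ 2 ≤
      (n / μ * supNorm (e ω) *
        (|φ (X ω + μ • e ω) (η ω) - φ (X ω) (η ω)| + 2 * δ)) ^ 2 := by
  filter_upwards [h.noise_le, h.noise₀_le] with ω h_noise h_noise₀
  exact pow_le_pow_left₀ (supNorm_nonneg _) (supNorm_gradEstimate_le hμ h_noise h_noise₀ _ _ _) 2

variable [IsProbabilityMeasure P]

theorem indep_realisation_query (h : OracleStep P ν δ X e η ξ ξ₀) :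
    IndepFun η (fun ω => (e ω, X ω)) P :=
  (indepFun_prodMk_left_of_prodMk_right h.direction.measurable h.measurable_point
    h.realisation.measurable h.indep_direction h.indep_realisation.symm).symm

theorem integrable_noise (h : OracleStep P ν δ X e η ξ ξ₀) : Integrable ξ P :=
  .of_bound h.measurable_noise.aestronglyMeasurable δ h.noise_le

theorem integrable_noise₀ (h : OracleStep P ν δ X e η ξ ξ₀) : Integrable ξ₀ P :=
  .of_bound h.measurable_noise₀.aestronglyMeasurable δ h.noise₀_le

theorem noise_bound_nonneg (h : OracleStep P ν δ X e η ξ ξ₀) : 0 ≤ δ := by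
  obtain ⟨ω, hω⟩ := h.noise_le.exists
  exact (abs_nonneg _).trans hω

variable [NeZero n]

theorem integral_mul_inner_eq_zero (h : OracleStep P ν δ X e η ξ ξ₀) {ζ : Ω → ℝ}
    (hζ : Measurable ζ) (hζi : Integrable ζ P) (h_indep : IndepFun e (fun ω => (X ω, ζ ω)) P)
    (u : Vec n) : ∫ ω, ζ ω * inner ℝ (e ω) (X ω - u) ∂P = 0 := by
  have hi := h.integrable_mul_inner hζi u
  simp only [← real_inner_smul_right] at hi ⊢
  exact integral_inner_eq_zero_of_indepFun h.direction
    (hζ.smul (h.measurable_point.sub_const u))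
    (h_indep.comp (ψ := fun p : Vec n × ℝ => p.2 • (p.1 - u)) measurable_id (by fun_prop)) hi

variable [IsProbabilityMeasure ν]

theorem integral_shift_mul_inner_eq (h : OracleStep P ν δ X e η ξ ξ₀)
    (hf : SmoothSetting ν μ₀ φ K L) (hφ : Measurable (Function.uncurry φ)) (hμ : 0 ≤ μ)
    (hμ₀ : μ ≤ μ₀) (u : Vec n) :
    ∫ ω, φ (X ω + μ • e ω) (η ω) * inner ℝ (e ω) (X ω - u) ∂P =
      ∫ ω, objective ν φ (X ω + μ • e ω) * inner ℝ (e ω) (X ω - u) ∂P := by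
  have hi := h.integrable_mul_inner (h.integrable_shift_value hf hφ hμ hμ₀) u
  have hG : Measurable fun p : H × Vec n × Vec n =>
      φ (p.2.2 + μ • p.2.1) p.1 * inner ℝ p.2.1 (p.2.2 - u) :=
    Measurable.mul (hφ.comp (by fun_prop : Measurable fun p : H × Vec n × Vec n =>
      (p.2.2 + μ • p.2.1, p.1))) (by fun_prop)
  rw [integral_eq_integral_integral_of_indepFun h.realisation
    (h.direction.measurable.prodMk h.measurable_point) h.indep_realisation_query
    hG.stronglyMeasurable hi]
  simp only [integral_mul_const, objective]

theorem sub_sub_min_le_integral_shift_mul_inner (h : OracleStep P ν δ X e η ξ ξ₀)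
    (hf : SmoothSetting ν μ₀ φ K L) (hφ : Measurable (Function.uncurry φ)) (hμ : 0 < μ)
    (hμ₀ : μ ≤ μ₀) {u : Vec n} (hu : u ∈ simplex n) :
    ∫ ω, objective ν φ (X ω) ∂P - objective ν φ u - min (rms ν K * μ) (rms ν L / 2 * μ ^ 2) ≤
      n / μ * ∫ ω, φ (X ω + μ • e ω) (η ω) * inner ℝ (e ω) (X ω - u) ∂P := by
  have hF := measurable_objective (ν := ν) hφ
  have hG : StronglyMeasurable fun p : Vec n × Vec n =>
      objective ν φ (p.2 + μ • p.1) * inner ℝ p.1 (p.2 - u) :=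
    Measurable.stronglyMeasurable (by fun_prop)
  have hi := h.integrable_mul_inner (hf.integrable_objective_comp hφ
    (h.measurable_point.add (h.direction.measurable.const_smul μ)) (h.shift_mem hμ.le hμ₀)) u
  have hi_sphere := integrable_integral_of_indepFun h.direction h.measurable_point
    h.indep_direction_point hG hi
  have hi_point := hf.integrable_objective_comp hφ h.measurable_point
    (ae_of_all P fun ω => simplex_subset_closedNhd (h.point_mem ω))
  calc ∫ ω, objective ν φ (X ω) ∂P - objective ν φ u - min (rms ν K * μ) (rms ν L / 2 * μ ^ 2)
      = ∫ ω, (objective ν φ (X ω) - objective ν φ u -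
          min (rms ν K * μ) (rms ν L / 2 * μ ^ 2)) ∂P := by
        simp only [sub_sub]
        rw [integral_sub hi_point (integrable_const _), integral_const, probReal_univ, one_smul]
    _ ≤ ∫ ω, n / μ * ∫ d, objective ν φ (X ω + μ • d) * inner ℝ d (X ω - u)
          ∂uniformSphere n ∂P := by
        refine integral_mono ((hi_point.sub (integrable_const _)).sub (integrable_const _))
          (hi_sphere.const_mul _) fun ω => ?_
        exact hf.smoothConvexOn_objective.sub_sub_min_le_integral_uniformSphere
          (ball_subset_openNhd (h.point_mem ω) hμ₀)
          (closedBall_subset_closedNhd (h.point_mem ω) hμ₀)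
          (ball_subset_openNhd hu hμ₀) (closedBall_subset_closedNhd hu hμ₀) hμ
    _ = n / μ * ∫ ω, φ (X ω + μ • e ω) (η ω) * inner ℝ (e ω) (X ω - u) ∂P := by
        rw [integral_const_mul, h.integral_shift_mul_inner_eq hf hφ hμ.le hμ₀,
          integral_eq_integral_integral_of_indepFun h.direction h.measurable_point
            h.indep_direction_point hG hi]

theorem integrable_inner_gradEstimate (h : OracleStep P ν δ X e η ξ ξ₀)
    (hf : SmoothSetting ν μ₀ φ K L) (hφ : Measurable (Function.uncurry φ)) (hμ : 0 ≤ μ)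
    (hμ₀ : μ ≤ μ₀) (u : Vec n) :
    Integrable (fun ω =>
      inner ℝ (gradEstimate φ μ (X ω) (e ω) (η ω) (ξ ω) (ξ₀ ω)) (X ω - u)) P := by
  simp only [gradEstimate, real_inner_smul_left, mul_assoc]
  exact (h.integrable_mul_inner (((h.integrable_shift_value hf hφ hμ hμ₀).add
    h.integrable_noise).sub ((h.integrable_value hf hφ).add h.integrable_noise₀)) u).const_mul _

theorem integral_inner_gradEstimate (h : OracleStep P ν δ X e η ξ ξ₀)
    (hf : SmoothSetting ν μ₀ φ K L) (hφ : Measurable (Function.uncurry φ)) (hμ : 0 ≤ μ)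
    (hμ₀ : μ ≤ μ₀) (u : Vec n) :
    ∫ ω, inner ℝ (gradEstimate φ μ (X ω) (e ω) (η ω) (ξ ω) (ξ₀ ω)) (X ω - u) ∂P =
      n / μ * ∫ ω, φ (X ω + μ • e ω) (η ω) * inner ℝ (e ω) (X ω - u) ∂P := by
  have hi_shift := h.integrable_mul_inner (h.integrable_shift_value hf hφ hμ hμ₀) u
  have hi_noise := h.integrable_mul_inner h.integrable_noise u
  have hi_value := h.integrable_mul_inner (h.integrable_value hf hφ) u
  have hi_noise₀ := h.integrable_mul_inner h.integrable_noise₀ u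
  have h_value : ∫ ω, φ (X ω) (η ω) * inner ℝ (e ω) (X ω - u) ∂P = 0 :=
    h.integral_mul_inner_eq_zero (hφ.comp (h.measurable_point.prodMk h.realisation.measurable))
      (h.integrable_value hf hφ)
      (h.indep_direction.comp measurable_id (measurable_fst.prodMk hφ)) u
  simp only [gradEstimate, real_inner_smul_left, mul_assoc, sub_mul, add_mul]
  rw [integral_const_mul, integral_sub (hi_shift.fun_add hi_noise)
      (hi_value.fun_add hi_noise₀),
    integral_add hi_shift hi_noise, integral_add hi_value hi_noise₀, h_value,
    h.integral_mul_inner_eq_zero h.measurable_noise h.integrable_noise h.indep_noise,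
    h.integral_mul_inner_eq_zero h.measurable_noise₀ h.integrable_noise₀ h.indep_noise₀,
    add_zero, add_zero, sub_zero]

theorem sub_sub_min_le_integral_inner_gradEstimate (h : OracleStep P ν δ X e η ξ ξ₀)
    (hf : SmoothSetting ν μ₀ φ K L) (hφ : Measurable (Function.uncurry φ)) (hμ : 0 < μ)
    (hμ₀ : μ ≤ μ₀) {u : Vec n} (hu : u ∈ simplex n) :
    ∫ ω, objective ν φ (X ω) ∂P - objective ν φ u - min (rms ν K * μ) (rms ν L / 2 * μ ^ 2) ≤
      ∫ ω, inner ℝ (gradEstimate φ μ (X ω) (e ω) (η ω) (ξ ω) (ξ₀ ω)) (X ω - u) ∂P :=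
  (h.sub_sub_min_le_integral_shift_mul_inner hf hφ hμ hμ₀ hu).trans_eq
    (h.integral_inner_gradEstimate hf hφ hμ.le hμ₀ u).symm

theorem integrable_sq_supNorm_mul (h : OracleStep P ν δ X e η ξ ξ₀)
    (hf : SmoothSetting ν μ₀ φ K L) (hφ : Measurable (Function.uncurry φ)) (hμ : 0 < μ)
    (hμ₀ : μ ≤ μ₀) : Integrable (fun ω => (n / μ * supNorm (e ω) *
      (|φ (X ω + μ • e ω) (η ω) - φ (X ω) (η ω)| + 2 * δ)) ^ 2) P := by
  have h_dom : MemLp (fun ω => n / μ * (K (η ω) * μ + 2 * δ)) 2 P :=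
    (((hf.lipschitz_memLp.comp_measurePreserving h.realisation).mul_const μ).add
      (memLp_const (2 * δ))).const_mul _
  have h_meas := (continuous_supNorm.measurable.comp h.direction.measurable).aestronglyMeasurable
    (μ := P)
  refine h_dom.integrable_sq.mono' (((h_meas.const_mul _).mul
    (((h.integrable_shift_value hf hφ hμ.le hμ₀).sub (h.integrable_value hf hφ)).1.norm.add
      aestronglyMeasurable_const)).pow 2) ?_
  filter_upwards [ae_norm_eq_one h.direction, h.shift_mem hμ.le hμ₀,
    h.realisation.quasiMeasurePreserving.ae hf.lipschitz] with ω he h_shift h_lip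
  have h_increment : |φ (X ω + μ • e ω) (η ω) - φ (X ω) (η ω)| ≤ K (η ω) * μ := by
    simpa [norm_smul, he, abs_of_pos hμ] using
      h_lip _ h_shift _ (simplex_subset_closedNhd (h.point_mem ω))
  have h_supNorm : supNorm (e ω) ≤ 1 := he ▸ supNorm_le_norm (e ω)
  have := supNorm_nonneg (e ω)
  have := h.noise_bound_nonneg
  rw [Real.norm_of_nonneg (sq_nonneg _), mul_assoc]
  gcongr
  nlinarith [abs_nonneg (φ (X ω + μ • e ω) (η ω) - φ (X ω) (η ω))]

theorem integral_sq_supNorm_mul_le (h : OracleStep P ν δ X e η ξ ξ₀)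
    (hf : SmoothSetting ν μ₀ φ K L) (hφ : Measurable (Function.uncurry φ)) (hμ : 0 < μ)
    (hμ₀ : μ ≤ μ₀) : ∫ ω, (n / μ * supNorm (e ω) *
      (|φ (X ω + μ • e ω) (η ω) - φ (X ω) (η ω)| + 2 * δ)) ^ 2 ∂P ≤
        n * supMoment n * (7 / 5 * rms ν K ^ 2 +
          7 * n * (rms ν L ^ 2 * μ ^ 2 / 4 + 4 * δ ^ 2 / μ ^ 2)) := by
  have hi := h.integrable_sq_supNorm_mul hf hφ hμ hμ₀
  have h_meas := h.measurable_point.prodMk h.realisation.measurable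
  have hG : Measurable fun p : Vec n × Vec n × H =>
      (n / μ * supNorm p.1 * (|φ (p.2.1 + μ • p.1) p.2.2 - φ p.2.1 p.2.2| + 2 * δ)) ^ 2 :=
    ((continuous_supNorm.measurable.comp measurable_fst).const_mul _ |>.mul
      (((hφ.comp (by fun_prop : Measurable fun p : Vec n × Vec n × H =>
        (p.2.1 + μ • p.1, p.2.2))).sub (hφ.comp measurable_snd)).norm.add_const _)).pow_const 2
  have hi_sphere := integrable_integral_of_indepFun h.direction h_meas h.indep_direction
    hG.stronglyMeasurable hi
  have hK_term := (h.integrable_sq_comp_realisation hf.lipschitz_memLp).const_mul (7 / 5)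
  have hL_term := ((h.integrable_sq_comp_realisation hf.gradient_lipschitz_memLp).mul_const
    (μ ^ 2)).div_const 4
  have hL_sum := (hL_term.fun_add (integrable_const (4 * δ ^ 2 / μ ^ 2))).const_mul (7 * n)
  calc ∫ ω, (n / μ * supNorm (e ω) *
        (|φ (X ω + μ • e ω) (η ω) - φ (X ω) (η ω)| + 2 * δ)) ^ 2 ∂P
      = ∫ ω, ∫ d, (n / μ * supNorm d *
          (|φ (X ω + μ • d) (η ω) - φ (X ω) (η ω)| + 2 * δ)) ^ 2 ∂uniformSphere n ∂P :=
        integral_eq_integral_integral_of_indepFun h.direction h_meas h.indep_direction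
          hG.stronglyMeasurable hi
    _ ≤ ∫ ω, n * supMoment n * (7 / 5 * K (η ω) ^ 2 +
          7 * n * (L (η ω) ^ 2 * μ ^ 2 / 4 + 4 * δ ^ 2 / μ ^ 2)) ∂P := by
        refine integral_mono_ae hi_sphere ((hK_term.add hL_sum).const_mul _) ?_
        filter_upwards [h.realisation.quasiMeasurePreserving.ae hf.ae_smoothConvexOn] with ω hω
        exact hω.integral_uniformSphere_sq_supNorm_mul_le
          (ball_subset_openNhd (h.point_mem ω) hμ₀)
          (closedBall_subset_closedNhd (h.point_mem ω) hμ₀) hμ h.noise_bound_nonneg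
    _ = _ := by
        rw [integral_const_mul, integral_add hK_term hL_sum, integral_const_mul,
          integral_const_mul, integral_add hL_term (integrable_const _), integral_div,
          integral_mul_const, integral_const, probReal_univ, one_smul,
          h.integral_sq_comp_realisation hf.lipschitz_memLp,
          h.integral_sq_comp_realisation hf.gradient_lipschitz_memLp]

theorem integrable_sq_supNorm_gradEstimate (h : OracleStep P ν δ X e η ξ ξ₀)
    (hf : SmoothSetting ν μ₀ φ K L) (hφ : Measurable (Function.uncurry φ)) (hμ : 0 < μ)
    (hμ₀ : μ ≤ μ₀) : Integrable (fun ω =>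
      supNorm (gradEstimate φ μ (X ω) (e ω) (η ω) (ξ ω) (ξ₀ ω)) ^ 2) P := by
  have h_meas := measurable_gradEstimate hφ μ h.measurable_point h.direction.measurable
    h.realisation.measurable h.measurable_noise h.measurable_noise₀
  refine (h.integrable_sq_supNorm_mul hf hφ hμ hμ₀).mono'
    ((continuous_supNorm.measurable.comp h_meas).pow_const 2).aestronglyMeasurable ?_
  simpa only [Function.comp_apply, norm_pow, Real.norm_eq_abs, sq_abs] using
    h.sq_supNorm_gradEstimate_ae_le hμ

theorem integral_sq_supNorm_gradEstimate_le (h : OracleStep P ν δ X e η ξ ξ₀)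
    (hf : SmoothSetting ν μ₀ φ K L) (hφ : Measurable (Function.uncurry φ)) (hμ : 0 < μ)
    (hμ₀ : μ ≤ μ₀) :
    ∫ ω, supNorm (gradEstimate φ μ (X ω) (e ω) (η ω) (ξ ω) (ξ₀ ω)) ^ 2 ∂P ≤
      n * supMoment n * (7 / 5 * rms ν K ^ 2 +
        7 * n * (rms ν L ^ 2 * μ ^ 2 / 4 + 4 * δ ^ 2 / μ ^ 2)) :=
  (integral_mono_ae (h.integrable_sq_supNorm_gradEstimate hf hφ hμ hμ₀)
    (h.integrable_sq_supNorm_mul hf hφ hμ hμ₀) (h.sq_supNorm_gradEstimate_ae_le hμ)).trans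
      (h.integral_sq_supNorm_mul_le hf hφ hμ hμ₀)

end OracleStep

end OracleStep

/-! ### The run of the method -/

section Run

variable {n : ℕ} {H Ω : Type*} {φ : Vec n → H → ℝ} {μ M₂ : ℝ} {e : ℕ → Ω → Vec n}
  {η : ℕ → Ω → H} {ξ ξ₀ : ℕ → Ω → ℝ}

theorem measurable_mirror (β : ℝ) : Measurable (mirror β : Vec n → Vec n) :=
  (PiLp.continuous_toLp 2 _).measurable.comp (measurable_pi_lambda _ fun i => by fun_prop)

/-- The gradient estimate formed along the run at `iterate t`. -/
def runEstimate (φ : Vec n → H → ℝ) (μ M₂ : ℝ) (e : ℕ → Ω → Vec n) (η : ℕ → Ω → H)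
    (ξ ξ₀ : ℕ → Ω → ℝ) (t : ℕ) (ω : Ω) : Vec n :=
  gradEstimate φ μ (iterate φ μ M₂ e η ξ ξ₀ t ω) (e t ω) (η t ω) (ξ t ω) (ξ₀ t ω)

theorem estimateSum_eq_sum_runEstimate (t : ℕ) (ω : Ω) : estimateSum φ μ M₂ e η ξ ξ₀ ω t =
    ∑ k ∈ Finset.range t, runEstimate φ μ M₂ e η ξ ξ₀ k ω := by
  induction t with
  | zero => rfl
  | succ t ih => rw [Finset.sum_range_succ, ← ih]; rfl

theorem exists_measurable_estimateSum_eq_comp_history [MeasurableSpace H]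
    (hφ : Measurable (Function.uncurry φ)) (t : ℕ) :
    ∃ Φ : (Fin t → Vec n × H × ℝ × ℝ) → Vec n, Measurable Φ ∧
      ∀ ω, estimateSum φ μ M₂ e η ξ ξ₀ ω t = Φ (history e η ξ ξ₀ t ω) := by
  induction t with
  | zero => exact ⟨fun _ => 0, measurable_const, fun _ => rfl⟩
  | succ t ih =>
    obtain ⟨Φ, hΦ, h_eq⟩ := ih
    let past (p : Fin (t + 1) → Vec n × H × ℝ × ℝ) : Vec n := Φ (Fin.init p)
    have h_past : Measurable past :=
      hΦ.comp (measurable_pi_lambda _ fun j => measurable_pi_apply j.castSucc)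
    have h_last : Measurable fun p : Fin (t + 1) → Vec n × H × ℝ × ℝ => p (Fin.last t) :=
      measurable_pi_apply _
    refine ⟨fun p => past p + gradEstimate φ μ (mirror (stepParam M₂ (t + 1)) (past p))
      (p (Fin.last t)).1 (p (Fin.last t)).2.1 (p (Fin.last t)).2.2.1 (p (Fin.last t)).2.2.2,
      h_past.add (measurable_gradEstimate hφ μ ((measurable_mirror _).comp h_past) h_last.fst
        h_last.snd.fst h_last.snd.snd.fst h_last.snd.snd.snd), fun ω => ?_⟩
    rw [estimateSum, h_eq]
    rfl

variable [NeZero n]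

theorem iterate_mem_simplex (t : ℕ) (ω : Ω) : iterate φ μ M₂ e η ξ ξ₀ t ω ∈ simplex n :=
  mirror_mem_simplex _ _

theorem average_mem_simplex {N : ℕ} (hN : 0 < N) (ω : Ω) :
    average φ μ M₂ e η ξ ξ₀ N ω ∈ simplex n := by
  rw [average, Finset.smul_sum]
  refine convex_simplex.sum_mem (fun _ _ => by positivity) ?_ fun t _ => iterate_mem_simplex t ω
  simp [hN.ne']

theorem sum_inner_runEstimate_le (hM : 0 < M₂) {u : Vec n} (hu : u ∈ simplex n) (N : ℕ) (ω : Ω) :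
    ∑ t ∈ Finset.range N,
        inner ℝ (runEstimate φ μ M₂ e η ξ ξ₀ t ω) (iterate φ μ M₂ e η ξ ξ₀ t ω - u) ≤
      stepParam M₂ N * Real.log n + ∑ t ∈ Finset.range N,
        supNorm (runEstimate φ μ M₂ e η ξ ξ₀ t ω) ^ 2 / (2 * stepParam M₂ (t + 1)) := by
  cases N with
  | zero => simp [stepParam]
  | succ N =>
    simp only [iterate, estimateSum_eq_sum_runEstimate]
    exact dualAveraging_regret_le (fun t => runEstimate φ μ M₂ e η ξ ξ₀ t ω)
      (fun t => stepParam_pos hM t.succ_pos) (fun s t hst => stepParam_mono hM.le (by gcongr)) hu N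

theorem objective_average_le [MeasurableSpace H] {ν : Measure H} [IsProbabilityMeasure ν]
    {μ₀ : ℝ} {K L : H → ℝ} (hf : SmoothSetting ν μ₀ φ K L) {N : ℕ} (hN : 0 < N) (ω : Ω) :
    objective ν φ (average φ μ M₂ e η ξ ξ₀ N ω) ≤
      1 / N * ∑ t ∈ Finset.range N, objective ν φ (iterate φ μ M₂ e η ξ ξ₀ t ω) := by
  rw [average, Finset.smul_sum, Finset.mul_sum]
  refine hf.convexOn_objective.map_sum_le (fun _ _ => by positivity) ?_
    fun t _ => simplex_subset_closedNhd (iterate_mem_simplex t ω)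
  simp [hN.ne']

end Run

section ExpectedGap

variable {n : ℕ} {H Ω : Type*} [MeasurableSpace H] [MeasurableSpace Ω]
  {ν : Measure H} {P : Measure Ω} {φ : Vec n → H → ℝ} {K L : H → ℝ} {μ₀ μ δ M₂ : ℝ}
  {e : ℕ → Ω → Vec n} {η : ℕ → Ω → H} {ξ ξ₀ : ℕ → Ω → ℝ} {u : Vec n} {N : ℕ}

theorem OracleModel.measurable_history (ho : OracleModel P ν δ e η ξ ξ₀) (t : ℕ) :
    Measurable (history e η ξ ξ₀ t) :=
  measurable_pi_lambda _ fun j => (ho.measurable_direction j).prodMk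
    ((ho.measurable_realisation j).prodMk ((ho.measurable_noise j).prodMk (ho.measurable_noise₀ j)))

variable [NeZero n]

theorem OracleModel.oracleStep (ho : OracleModel P ν δ e η ξ ξ₀)
    (hφ : Measurable (Function.uncurry φ)) (μ M₂ : ℝ) (t : ℕ) :
    OracleStep P ν δ (iterate φ μ M₂ e η ξ ξ₀ t) (e t) (η t) (ξ t) (ξ₀ t) := by
  obtain ⟨Φ, hΦ, h_eq⟩ := exists_measurable_estimateSum_eq_comp_history (μ := μ) (M₂ := M₂)
    (e := e) (η := η) (ξ := ξ) (ξ₀ := ξ₀) hφ t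
  let x (p : Fin t → Vec n × H × ℝ × ℝ) : Vec n := mirror (stepParam M₂ (t + 1)) (Φ p)
  have hx : Measurable x := (measurable_mirror _).comp hΦ
  have h_iterate : iterate φ μ M₂ e η ξ ξ₀ t = fun ω => x (history e η ξ ξ₀ t ω) :=
    funext fun ω => congrArg (mirror _) (h_eq ω)
  rw [h_iterate]
  exact
    { measurable_point := hx.comp (ho.measurable_history t)
      point_mem := fun ω => mirror_mem_simplex _ _
      direction := ⟨ho.measurable_direction t, ho.law_direction t⟩
      realisation := ⟨ho.measurable_realisation t, ho.law_realisation t⟩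
      measurable_noise := ho.measurable_noise t
      measurable_noise₀ := ho.measurable_noise₀ t
      noise_le := ho.noise_le t
      noise₀_le := ho.noise₀_le t
      indep_realisation := (ho.indep_realisation t).comp measurable_id hx
      indep_direction := (ho.indep_direction t).comp measurable_id (hx.prodMap measurable_id)
      indep_noise := (ho.indep_noise t).comp measurable_id (hx.prodMap measurable_id)
      indep_noise₀ := (ho.indep_noise₀ t).comp measurable_id (hx.prodMap measurable_id) }

variable [IsProbabilityMeasure ν] [IsProbabilityMeasure P]

theorem OracleModel.integrable_objective_iterate (ho : OracleModel P ν δ e η ξ ξ₀)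
    (hf : SmoothSetting ν μ₀ φ K L) (hφ : Measurable (Function.uncurry φ)) (t : ℕ) :
    Integrable (fun ω => objective ν φ (iterate φ μ M₂ e η ξ ξ₀ t ω)) P :=
  hf.integrable_objective_comp hφ (ho.oracleStep hφ μ M₂ t).measurable_point
    (ae_of_all P fun ω => simplex_subset_closedNhd (iterate_mem_simplex t ω))

theorem OracleModel.integrable_objective_average (ho : OracleModel P ν δ e η ξ ξ₀)
    (hf : SmoothSetting ν μ₀ φ K L) (hφ : Measurable (Function.uncurry φ)) (hN : 0 < N) :
    Integrable (fun ω => objective ν φ (average φ μ M₂ e η ξ ξ₀ N ω)) P := by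
  have h_average : Measurable (average φ μ M₂ e η ξ ξ₀ N) :=
    (Finset.measurable_sum _ fun t _ => (ho.oracleStep hφ μ M₂ t).measurable_point).const_smul
      (1 / (N : ℝ))
  exact hf.integrable_objective_comp hφ h_average
    (ae_of_all P fun ω => simplex_subset_closedNhd (average_mem_simplex hN ω))

theorem OracleModel.integral_objective_average_le (ho : OracleModel P ν δ e η ξ ξ₀)
    (hf : SmoothSetting ν μ₀ φ K L) (hφ : Measurable (Function.uncurry φ)) (hN : 0 < N) :
    ∫ ω, objective ν φ (average φ μ M₂ e η ξ ξ₀ N ω) ∂P ≤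
      1 / N * ∑ t ∈ Finset.range N, ∫ ω, objective ν φ (iterate φ μ M₂ e η ξ ξ₀ t ω) ∂P := by
  have hi (t) := ho.integrable_objective_iterate (μ := μ) (M₂ := M₂) hf hφ t
  rw [← integral_finsetSum _ fun t _ => hi t, ← integral_const_mul]
  exact integral_mono (ho.integrable_objective_average hf hφ hN)
    ((integrable_finsetSum _ fun t _ => hi t).const_mul _) fun ω => objective_average_le hf hN ω

theorem OracleModel.sum_integral_inner_runEstimate_le (ho : OracleModel P ν δ e η ξ ξ₀)
    (hf : SmoothSetting ν μ₀ φ K L) (hφ : Measurable (Function.uncurry φ)) (hμ : 0 < μ)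
    (hμ₀ : μ ≤ μ₀) (hM : 0 < M₂)
    (h_moment : n * supMoment n * (7 / 5 * rms ν K ^ 2 +
      7 * n * (rms ν L ^ 2 * μ ^ 2 / 4 + 4 * δ ^ 2 / μ ^ 2)) ≤ 5 * M₂ ^ 2 * Real.log n)
    (hu : u ∈ simplex n) (N : ℕ) :
    ∑ t ∈ Finset.range N, ∫ ω, inner ℝ (runEstimate φ μ M₂ e η ξ ξ₀ t ω)
      (iterate φ μ M₂ e η ξ ξ₀ t ω - u) ∂P ≤ 2 * (stepParam M₂ N * Real.log n) := by
  have h_step := ho.oracleStep hφ μ M₂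
  have hi_inner (t) := (h_step t).integrable_inner_gradEstimate hf hφ hμ.le hμ₀ u
  have hi_sq (t) : Integrable (fun ω =>
      supNorm (runEstimate φ μ M₂ e η ξ ξ₀ t ω) ^ 2 / (2 * stepParam M₂ (t + 1))) P :=
    ((h_step t).integrable_sq_supNorm_gradEstimate hf hφ hμ hμ₀).div_const _
  have hi_sum := integrable_finsetSum (Finset.range N) fun t _ => hi_sq t
  have h_sq_le (t) : ∫ ω, supNorm (runEstimate φ μ M₂ e η ξ ξ₀ t ω) ^ 2 ∂P ≤
      5 * M₂ ^ 2 * Real.log n :=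
    ((h_step t).integral_sq_supNorm_gradEstimate_le hf hφ hμ hμ₀).trans h_moment
  calc
    _ = ∫ ω, ∑ t ∈ Finset.range N, inner ℝ (runEstimate φ μ M₂ e η ξ ξ₀ t ω)
          (iterate φ μ M₂ e η ξ ξ₀ t ω - u) ∂P :=
        (integral_finsetSum _ fun t _ => hi_inner t).symm
    _ ≤ ∫ ω, (stepParam M₂ N * Real.log n + ∑ t ∈ Finset.range N,
          supNorm (runEstimate φ μ M₂ e η ξ ξ₀ t ω) ^ 2 / (2 * stepParam M₂ (t + 1))) ∂P :=
        integral_mono (integrable_finsetSum _ fun t _ => hi_inner t)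
          ((integrable_const _).add hi_sum) (sum_inner_runEstimate_le hM hu N)
    _ = stepParam M₂ N * Real.log n + ∑ t ∈ Finset.range N,
          (∫ ω, supNorm (runEstimate φ μ M₂ e η ξ ξ₀ t ω) ^ 2 ∂P) /
            (2 * stepParam M₂ (t + 1)) := by
        rw [integral_add (integrable_const _) hi_sum, integral_const, probReal_univ, one_smul,
          integral_finsetSum _ fun t _ => hi_sq t]
        simp only [integral_div]
    _ ≤ stepParam M₂ N * Real.log n + ∑ t ∈ Finset.range N,
          5 * M₂ ^ 2 * Real.log n / (2 * stepParam M₂ (t + 1)) := by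
        gcongr with t
        · exact mul_nonneg zero_le_two (stepParam_pos hM t.succ_pos).le
        · exact h_sq_le t
    _ ≤ 2 * (stepParam M₂ N * Real.log n) := by
        have h_log := mul_le_mul_of_nonneg_right (sum_div_stepParam_le hM N)
          (Real.log_natCast_nonneg n)
        simp only [Finset.sum_mul, ← mul_div_right_comm] at h_log
        linarith

theorem OracleModel.integral_objective_average_sub_le (ho : OracleModel P ν δ e η ξ ξ₀)
    (hf : SmoothSetting ν μ₀ φ K L) (hφ : Measurable (Function.uncurry φ)) (hμ : 0 < μ)
    (hμ₀ : μ ≤ μ₀) (hM : 0 < M₂)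
    (h_moment : n * supMoment n * (7 / 5 * rms ν K ^ 2 +
      7 * n * (rms ν L ^ 2 * μ ^ 2 / 4 + 4 * δ ^ 2 / μ ^ 2)) ≤ 5 * M₂ ^ 2 * Real.log n)
    (hu : u ∈ simplex n) (hN : 0 < N) :
    ∫ ω, objective ν φ (average φ μ M₂ e η ξ ξ₀ N ω) ∂P - objective ν φ u ≤
      min (rms ν K * μ) (rms ν L / 2 * μ ^ 2) + 2 * (stepParam M₂ N * Real.log n) / N := by
  have hN_pos : (0 : ℝ) < N := Nat.cast_pos.2 hN
  have h_jensen := ho.integral_objective_average_le (μ := μ) (M₂ := M₂) hf hφ hN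
  have h_regret : ∑ t ∈ Finset.range N, (∫ ω, objective ν φ (iterate φ μ M₂ e η ξ ξ₀ t ω) ∂P -
      objective ν φ u - min (rms ν K * μ) (rms ν L / 2 * μ ^ 2)) ≤
        2 * (stepParam M₂ N * Real.log n) :=
    (Finset.sum_le_sum fun t _ =>
      (ho.oracleStep hφ μ M₂ t).sub_sub_min_le_integral_inner_gradEstimate hf hφ hμ hμ₀ hu).trans
      (ho.sum_integral_inner_runEstimate_le hf hφ hμ hμ₀ hM h_moment hu N)
  rw [Finset.sum_sub_distrib, Finset.sum_sub_distrib, Finset.sum_const, Finset.sum_const,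
    Finset.card_range, nsmul_eq_mul, nsmul_eq_mul] at h_regret
  rw [one_div_mul_eq_div, le_div_iff₀ hN_pos] at h_jensen
  rw [← sub_le_iff_le_add', le_div_iff₀ hN_pos]
  linarith

theorem OracleModel.integral_objective_average_iterationCount_sub_le
    (ho : OracleModel P ν δ e η ξ ξ₀) (hf : SmoothSetting ν μ₀ φ K L)
    (hφ : Measurable (Function.uncurry φ)) (hn : 2 ≤ n) {ε : ℝ} (hε : 0 < ε) (hK : 0 < rms ν K)
    (hL : 0 < rms ν L) (hμ : μ = smoothingRadius n ε (rms ν K) (rms ν L)) (hμ₀ : μ ≤ μ₀)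
    (hδ : δ ≤ rms ν K * μ / √(96 * n)) (hu : u ∈ simplex n) :
    ∫ ω, objective ν φ (average φ μ (rms ν K) e η ξ ξ₀ (iterationCount n ε (rms ν K)) ω) ∂P -
      objective ν φ u ≤ ε := by
  have hμ_pos : 0 < μ := hμ ▸ smoothingRadius_pos (NeZero.pos n) hε hK hL
  have hδ_nonneg : 0 ≤ δ := (ho.oracleStep hφ μ (rms ν K) 0).noise_bound_nonneg
  have hN : 0 < iterationCount n ε (rms ν K) := iterationCount_pos hn hε hK
  have h_bias := min_le_half_of_le_max hε.le hK hL hμ_pos.le (hμ.trans_le (min_le_left _ _))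
  have h_moment := mul_supMoment_mul_le hn hL hδ_nonneg hμ_pos (hμ.trans_le (min_le_right _ _)) hδ
  have h_rate : 2 * (stepParam (rms ν K) (iterationCount n ε (rms ν K)) * Real.log n) /
      iterationCount n ε (rms ν K) ≤ ε / 2 :=
    div_le_of_le_mul₀ (Nat.cast_nonneg _) (by positivity)
      ((two_mul_stepParam_mul_log_le hε le_rfl).trans_eq (mul_comm _ _))
  linarith [ho.integral_objective_average_sub_le hf hφ hμ_pos hμ₀ hK h_moment hu hN]

end ExpectedGap

section Version

variable {n : ℕ} {H Ω : Type*} [MeasurableSpace H] [MeasurableSpace Ω] {ν : Measure H}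
  {P : Measure Ω} {f g : Vec n → H → ℝ} {K L : H → ℝ} {μ₀ μ δ M₂ : ℝ} {e : ℕ → Ω → Vec n}
  {η : ℕ → Ω → H} {ξ ξ₀ : ℕ → Ω → ℝ}

theorem objective_congr (hfg : ∀ᵐ h ∂ν, ∀ x ∈ closedNhd n μ₀, g x h = f x h) :
    EqOn (objective ν g) (objective ν f) (closedNhd n μ₀) :=
  fun x hx => integral_congr_ae (hfg.mono fun _ hh => hh x hx)

theorem eventuallyEq_of_eqOn_closedNhd {φ ψ : Vec n → ℝ} (h : EqOn φ ψ (closedNhd n μ₀))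
    {x : Vec n} (hx : x ∈ openNhd n μ₀) : φ =ᶠ[𝓝 x] ψ :=
  (h.mono (thickening_subset_cthickening _ _)).eventuallyEq_of_mem (isOpen_thickening.mem_nhds hx)

theorem SmoothSetting.congr (hf : SmoothSetting ν μ₀ f K L)
    (hfg : ∀ᵐ h ∂ν, ∀ x ∈ closedNhd n μ₀, g x h = f x h) : SmoothSetting ν μ₀ g K L where
  integrable x hx := (hf.integrable x hx).congr (hfg.mono fun h hh => (hh x hx).symm)
  convex := by
    filter_upwards [hf.convex, hfg] with h h_convex hh
    exact h_convex.congr fun x hx => (hh x hx).symm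
  gradient_expectation x hx := by
    have h_gradient : (fun h => gradient (fun y => g y h) x) =ᵐ[ν]
        fun h => gradient (fun y => f y h) x :=
      hfg.mono fun h hh => (eventuallyEq_of_eqOn_closedNhd hh hx).gradient_eq
    obtain ⟨h_int, h_grad⟩ := hf.gradient_expectation x hx
    refine ⟨h_int.congr h_gradient.symm, ?_⟩
    rw [integral_congr_ae h_gradient]
    exact h_grad.congr_of_eventuallyEq (eventuallyEq_of_eqOn_closedNhd (objective_congr hfg) hx)
  lipschitz := by
    filter_upwards [hf.lipschitz, hfg] with h h_lip hh x hx y hy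
    simpa only [hh x hx, hh y hy] using h_lip x hx y hy
  lipschitz_memLp := hf.lipschitz_memLp
  differentiable := by
    filter_upwards [hf.differentiable, hfg] with h h_diff hh x hx
    exact (h_diff x hx).congr_of_eventuallyEq (eventuallyEq_of_eqOn_closedNhd hh hx)
  gradient_lipschitz := by
    filter_upwards [hf.gradient_lipschitz, hfg] with h h_lip hh x hx y hy
    rw [(eventuallyEq_of_eqOn_closedNhd hh hx).gradient_eq,
      (eventuallyEq_of_eqOn_closedNhd hh hy).gradient_eq]
    exact h_lip x hx y hy
  gradient_lipschitz_memLp := hf.gradient_lipschitz_memLp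

theorem SmoothSetting.exists_isMinOn_objective [NeZero n] [IsProbabilityMeasure ν]
    (hf : SmoothSetting ν μ₀ f K L) : ∃ u ∈ simplex n, IsMinOn (objective ν f) (simplex n) u :=
  isCompact_simplex.exists_isMinOn simplex_nonempty
    (hf.smoothConvexOn_objective.continuousOn.mono simplex_subset_closedNhd)

variable [NeZero n]

theorem OracleModel.estimateSum_congr (ho : OracleModel P ν δ e η ξ ξ₀)
    (hfg : ∀ᵐ h ∂ν, ∀ x ∈ closedNhd n μ₀, g x h = f x h) (hμ : 0 ≤ μ) (hμ₀ : μ ≤ μ₀) :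
    ∀ᵐ ω ∂P, ∀ t, estimateSum g μ M₂ e η ξ ξ₀ ω t = estimateSum f μ M₂ e η ξ ξ₀ ω t := by
  have h_values : ∀ᵐ ω ∂P, ∀ t, ∀ x ∈ closedNhd n μ₀, g x (η t ω) = f x (η t ω) :=
    ae_all_iff.2 fun t => ae_of_ae_map (ho.measurable_realisation t).aemeasurable
      ((ho.law_realisation t).symm ▸ hfg)
  have h_norm : ∀ᵐ ω ∂P, ∀ t, ‖e t ω‖ = 1 :=
    ae_all_iff.2 fun t => ae_norm_eq_one ⟨ho.measurable_direction t, ho.law_direction t⟩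
  filter_upwards [h_values, h_norm] with ω h_values h_norm t
  induction t with
  | zero => rfl
  | succ t ih =>
    have h_mem := mirror_mem_simplex (stepParam M₂ (t + 1)) (estimateSum f μ M₂ e η ξ ξ₀ ω t)
    rw [estimateSum, estimateSum, ih, gradEstimate, gradEstimate,
      h_values t _ (add_smul_mem_closedNhd h_mem hμ hμ₀ (h_norm t)),
      h_values t _ (simplex_subset_closedNhd h_mem)]

theorem OracleModel.objective_average_congr (ho : OracleModel P ν δ e η ξ ξ₀)
    (hfg : ∀ᵐ h ∂ν, ∀ x ∈ closedNhd n μ₀, g x h = f x h) (hμ : 0 ≤ μ) (hμ₀ : μ ≤ μ₀) {N : ℕ}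
    (hN : 0 < N) : (fun ω => objective ν g (average g μ M₂ e η ξ ξ₀ N ω)) =ᵐ[P]
      fun ω => objective ν f (average f μ M₂ e η ξ ξ₀ N ω) := by
  filter_upwards [ho.estimateSum_congr (M₂ := M₂) hfg hμ hμ₀] with ω hω
  rw [objective_congr hfg (simplex_subset_closedNhd (average_mem_simplex hN ω))]
  simp only [average, iterate, hω]

end Version

end GradientFree

end

theorem mainTheorem2 {n : ℕ} (hn : 2 ≤ n)
    {H : Type*} [MeasurableSpace H] (ν : Measure H) [IsProbabilityMeasure ν]
    {Ω : Type*} [MeasurableSpace Ω] (P : Measure Ω) [IsProbabilityMeasure P]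
    (f : GradientFree.Vec n → H → ℝ) (K L : H → ℝ) (μ₀ ε δ M₂ L₂ μ : ℝ)
    (hf : GradientFree.SmoothSetting ν μ₀ f K L)
    (hM₂ : M₂ = GradientFree.rms ν K) (hM₂pos : 0 < M₂)
    (hL₂ : L₂ = GradientFree.rms ν L) (hL₂pos : 0 < L₂)
    (hε : 0 < ε)
    (hμ : μ = GradientFree.smoothingRadius n ε M₂ L₂) (hμμ₀ : μ ≤ μ₀)
    (hδ : δ ≤ M₂ * μ / Real.sqrt (96 * n))
    (e : ℕ → Ω → GradientFree.Vec n) (η : ℕ → Ω → H) (ξ ξ₀ : ℕ → Ω → ℝ)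
    (horacle : GradientFree.OracleModel P ν δ e η ξ ξ₀) :
    Integrable (fun ω => GradientFree.objective ν f
      (GradientFree.average f μ M₂ e η ξ ξ₀ (GradientFree.iterationCount n ε M₂) ω)) P ∧
    ∃ fmin : ℝ, IsLeast (GradientFree.objective ν f '' GradientFree.simplex n) fmin ∧
      (∫ ω, GradientFree.objective ν f
        (GradientFree.average f μ M₂ e η ξ ξ₀ (GradientFree.iterationCount n ε M₂) ω) ∂P) - fmin
        ≤ ε := by
  subst hM₂ hL₂
  have : NeZero n := ⟨by omega⟩
  have hμ_pos : 0 < μ := hμ ▸ GradientFree.smoothingRadius_pos (NeZero.pos n) hε hM₂pos hL₂pos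
  have hN := GradientFree.iterationCount_pos hn hε hM₂pos
  obtain ⟨g, hg, hfg⟩ := hf.exists_measurable_uncurry_eq
  have hf_version := hf.congr hfg
  have h_version := horacle.objective_average_congr (M₂ := GradientFree.rms ν K) hfg hμ_pos.le
    hμμ₀ hN
  obtain ⟨u, hu, h_min⟩ := hf.exists_isMinOn_objective
  refine ⟨(horacle.integrable_objective_average hf_version hg hN).congr h_version,
    GradientFree.objective ν f u, ⟨Set.mem_image_of_mem _ hu, Set.forall_mem_image.2 h_min⟩, ?_⟩
  rw [← integral_congr_ae h_version,
    ← GradientFree.objective_congr hfg (GradientFree.simplex_subset_closedNhd hu)]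
  exact horacle.integral_objective_average_iterationCount_sub_le hf_version hg hn hε hM₂pos hL₂pos
    hμ hμμ₀ hδ hu
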